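/- Let $\mathcal M$ be a finite set of positive integers, all divisible by $24$, let $\delta:\mathcal M\to\mathbb Z$, $m\mapsto\delta_m$, and consider the eta-quotient $\eta^\delta(q)=\prod_{m\in\mathcal M}\eta(q^m)^{\delta_m}$. Below, $m$ runs over $\mathcal M$. For $k\ge 1$ and $n\in\mathbb Z$, its HRR coefficient is $$A_k(n)=\sum_{\substack{0\le h<k\\ (h,k)=1}}\exp\Bigl(-2\pi i\Bigl(\tfrac{hn}{k}+\tfrac12\sum_m\delta_m\,s\bigl(\tfrac{mh}{\gcd(m,k)},\tfrac{k}{\gcd(m,k)}\bigr)\Bigr)\Bigr),$$ where $s(a,b)=\sum_{j=0}^{b-1}((\tfrac jb))((\tfrac{aj}b))$ is the Dedekind sum, with $((x))=x-\lfloor x\rfloor-\tfrac12$ for $x\notin\mathbb Z$ and $((x))=0$ for $x\in\mathbb Z$. For a Dirichlet character $\chi$ modulo $k$ and $a,b\in\mathbb Z$, let $$S_\chi(a,b;k)=\sum_{\substack{0\le h<k\\ (h,k)=1}}\chi(h)\exp\bigl(\tfrac{2\pi i}{k}(ah+b\overline h)\bigr),\qquad h\overline h\equiv1\pmod k.$$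 Fix $k\ge1$. Put $\lambda=\operatorname{val}_2(k)$ and, for each $m$, $k_m=k/\gcd(m,k)$, $m_k=m/\gcd(m,k)$, $\lambda_m=\operatorname{val}_2(k_m)$, $k_m'=k_m/2^{\lambda_m}$. Choose integers as follows. - $u_m=1$ if $3\mid k_m$; otherwise $u_m\equiv1\pmod{k_m}$ and $u_m\equiv0\pmod 3$. - $v_m$ is an inverse of $m_k$ modulo $\gcd(3,k_m)k_m$. - If $2\mid k_m$, $w_m$ is an inverse of $m_k$ modulo $2^{3+\lambda}$. - $t_1\equiv1\pmod{3k/2^\lambda}$ and $t_1\equiv0\pmod{2^{3+\lambda}}$. - $t_2\equiv1\pmod{2^{3+\lambda}}$ and $t_2\equiv0\pmod{3k/2^\lambda}$. Let $$a_1=-\sum_m\delta_mu_mm,\quad b_1=-\sum_m\delta_mu_mv_m\gcd(m,k),\quad a_2=-\sum_{2\mid k_m}\delta_mm,\quad b_2=-\sum_{2\mid k_m}\delta_mw_m\gcd(m,k)(k_m^2+3k_m+1),$$ $$a=\frac{t_1a_1+t_2a_2}{24},\qquad b=\frac{t_1b_1+t_2b_2}{24},\qquad c=\tfrac12\sum_{2\nmid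 k_m}\delta_m(k_m-3)+\sum_m\delta_m\left(\frac{(-1)^{k_m}m_k}{k_m'}\right),\qquad \chi=\prod_{2\nmid\delta_m}\left(\frac{\cdot}{k_m'}\right)$$ (Jacobi symbols), and for odd $h$ $$\psi(h)=\prod_{\substack{2\nmid\delta_m,\ 2\mid k_m\\ k_m'\equiv1\,(4)}}(-1)^{\frac{hm_k-1}{2}}\prod_{\substack{2\nmid\delta_m,\ 2\mid k_m\\ 2\nmid\lambda_m}}(-1)^{\frac{(hm_k)^2-1}{8}},\qquad \rho(h)=\psi(1)\psi(h).$$ Theorem. For every positive integer $k$ and all choices as above, $a$ and $b$ are integers, $\chi$ defines a Dirichlet character modulo $k$, $\rho$ is a character modulo $8$, there is a Dirichlet character $\chi\rho$ modulo $k$ with $(\chi\rho)(h)=\chi(h)\rho(h)$ for every $h$ coprime to $2k$, and for every $n\in\mathbb Z$ $$A_k(n)=i^{c}\,\psi(1)\,S_{\chi\rho}(a-n,b;k).$$ -/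

import Mathlib

open scoped BigOperators

noncomputable section

namespace HRR

/-- The sawtooth function `((x))`: `x - ⌊x⌋ - 1/2` if `x` is not an integer, and `0` otherwise. -/
def sawtooth (x : ℚ) : ℚ :=
  if Int.fract x = 0 then 0 else x - (⌊x⌋ : ℚ) - 1 / 2

/-- The Dedekind sum `s(a, b) = ∑_{0 ≤ j < b} ((j / b)) ((a j / b))`, for `b > 0`. -/
def dedekindSum (a : ℤ) (b : ℕ) : ℚ :=
  ∑ j ∈ Finset.range b, sawtooth ((j : ℚ) / (b : ℚ)) * sawtooth ((a : ℚ) * (j : ℚ) / (b : ℚ))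

/-- `k_m = k / gcd(m, k)`. -/
def kSub (k m : ℕ) : ℕ := k / Nat.gcd m k

/-- `m_k = m / gcd(m, k)`. -/
def mSub (k m : ℕ) : ℕ := m / Nat.gcd m k

/-- The odd part of a positive integer. -/
def oddPart (n : ℕ) : ℕ := n / 2 ^ padicValNat 2 n

/-- The Hardy-Ramanujan-Rademacher coefficient `A_k(n)` of the eta-quotient
`∏_{m ∈ M} η(q^m)^{δ m}`:
the sum over `0 ≤ h < k` with `gcd(h, k) = 1` of
`exp(-2πi (h n / k + (1/2) ∑_m δ_m s(m h / gcd(m, k), k / gcd(m, k))))`. -/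
def hrrCoeff (M : Finset ℕ) (δ : ℕ → ℤ) (k : ℕ) (n : ℤ) : ℂ :=
  ∑ h ∈ (Finset.range k).filter (fun h => Nat.Coprime h k),
    Complex.exp (-2 * (Real.pi : ℂ) * Complex.I *
      ((h : ℂ) * (n : ℂ) / (k : ℂ) +
        1 / 2 * ∑ m ∈ M, (δ m : ℂ) *
          ((dedekindSum ((mSub k m : ℤ) * (h : ℤ)) (kSub k m) : ℚ) : ℂ)))

/-- The twisted Kloosterman sum `S_χ(a, b; k)`: the sum over `0 ≤ h < k` with `gcd(h, k) = 1` of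
`χ(h) exp((2πi / k) (a h + b h'))`, where `h'` is an inverse of `h` modulo `k`
(here its representative in `[0, k)`). -/
def twistedKloosterman {k : ℕ} (χ : DirichletCharacter ℂ k) (a b : ℤ) : ℂ :=
  ∑ h ∈ (Finset.range k).filter (fun h => Nat.Coprime h k),
    χ (h : ZMod k) *
      Complex.exp (2 * (Real.pi : ℂ) * Complex.I / (k : ℂ) *
        ((a : ℂ) * (h : ℂ) + (b : ℂ) * (((h : ZMod k)⁻¹).val : ℂ)))

/-- `a₁ = -∑_m δ_m u_m m`. -/
def aOne (M : Finset ℕ) (δ u : ℕ → ℤ) : ℤ :=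
  -∑ m ∈ M, δ m * u m * (m : ℤ)

/-- `b₁ = -∑_m δ_m u_m v_m gcd(m, k)`. -/
def bOne (M : Finset ℕ) (δ : ℕ → ℤ) (k : ℕ) (u v : ℕ → ℤ) : ℤ :=
  -∑ m ∈ M, δ m * u m * v m * (Nat.gcd m k : ℤ)

/-- `a₂ = -∑_{2 ∣ k_m} δ_m m`. -/
def aTwo (M : Finset ℕ) (δ : ℕ → ℤ) (k : ℕ) : ℤ :=
  -∑ m ∈ M.filter (fun m => 2 ∣ kSub k m), δ m * (m : ℤ)

/-- `b₂ = -∑_{2 ∣ k_m} δ_m w_m gcd(m, k) (k_m² + 3 k_m + 1)`. -/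
def bTwo (M : Finset ℕ) (δ : ℕ → ℤ) (k : ℕ) (w : ℕ → ℤ) : ℤ :=
  -∑ m ∈ M.filter (fun m => 2 ∣ kSub k m),
    δ m * w m * (Nat.gcd m k : ℤ) * ((kSub k m : ℤ) ^ 2 + 3 * (kSub k m : ℤ) + 1)

/-- The sign `ψ(h)`, for odd `h`. The first product runs over the `m` with `δ_m` odd, `k_m` even
and odd part of `k_m` congruent to `1` modulo `4`; the second one over the `m` with `δ_m` odd,
`k_m` even and odd 2-adic valuation of `k_m`. In both, `h m_k` is odd, so the divisions are
exact. -/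
def psi (M : Finset ℕ) (δ : ℕ → ℤ) (k : ℕ) (h : ℤ) : ℤˣ :=
  (∏ m ∈ M.filter (fun m => ¬ (2 : ℤ) ∣ δ m ∧ 2 ∣ kSub k m ∧ oddPart (kSub k m) % 4 = 1),
      (-1 : ℤˣ) ^ ((h * (mSub k m : ℤ) - 1) / 2)) *
    ∏ m ∈ M.filter (fun m => ¬ (2 : ℤ) ∣ δ m ∧ 2 ∣ kSub k m ∧ ¬ 2 ∣ padicValNat 2 (kSub k m)),
      (-1 : ℤˣ) ^ (((h * (mSub k m : ℤ)) ^ 2 - 1) / 8)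

/-- The exponent
`c = ∑_{2 ∤ k_m} δ_m (k_m - 3) / 2 + ∑_m δ_m ((-1)^{k_m} m_k | k'_m)`,
with `k'_m` the odd part of `k_m` and `(· | ·)` the Jacobi symbol.
In the first sum `k_m - 3` is even, so the division is exact. -/
def cExp (M : Finset ℕ) (δ : ℕ → ℤ) (k : ℕ) : ℤ :=
  (∑ m ∈ M.filter (fun m => ¬ 2 ∣ kSub k m), δ m * (((kSub k m : ℤ) - 3) / 2)) +
    ∑ m ∈ M, δ m * jacobiSym ((-1) ^ kSub k m * (mSub k m : ℤ)) (oddPart (kSub k m))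

/-- The value at `h` of `χ = ∏_{2 ∤ δ_m} (· | k'_m)`, a product of Jacobi symbols. -/
def chiVal (M : Finset ℕ) (δ : ℕ → ℤ) (k : ℕ) (h : ℤ) : ℤ :=
  ∏ m ∈ M.filter (fun m => ¬ (2 : ℤ) ∣ δ m), jacobiSym h (oddPart (kSub k m))

end HRR

end

namespace HRR

/-! ### Dedekind sums -/

/-! Each summand of `A_k(n)` is a product over `m` of factors `exp(-πi s(H, K)) ^ δ_m` with `K =
k_m`, `H = m_k h`, so it suffices to evaluate one factor. The number `D = 12 K s(H, K)` is an
integer, and the factor depends only on `D` modulo `24 K`.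

Prime to 2, elementary sums give `H D ≡ H² + 1` modulo `K`, and modulo `3 K` when `3 ∣ K`, while `3
∣ D` otherwise (`three_mul_dvd_dedekindNum_sub`). At 2, Dedekind reciprocity and quadratic
reciprocity give `D ≡ K + 1 - 2 (H | K)` modulo 8 for odd `K` (`dedekindNum_modEq_eight`). One more
use of reciprocity gives `H D` modulo `8 K` for odd `H` (`mul_dedekindNum_modEq_eight_mul`), which
serves for even `K`.

Hence `D = E + 3 K x`, where `E` is linear in `h` and an inverse `h'`, glued from its two local
forms by `t₁` and `t₂`, and `x` modulo 8 is read off from a Jacobi symbol. The term `E` produces the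
Kloosterman phase and `x` produces a power of `i`. A sign in an exponent of `i` can be pulled out as
a factor, which separates the constant `i ^ c` from the character values
(`exp_dedekindSum_eq_etaSign`).

Since `24 ∣ m`, `8 k_m ∣ k` when `k_m` is even and `3 k_m ∣ k` when `3 ∣ k_m`. So a single inverse
of `h` modulo `k` serves all these moduli, and the factors modulo 8 are periodic modulo `k` whenever
they occur. In the product over `m`, signs survive only where `δ_m` is odd. -/

theorem sum_range_mul_emod {R : Type*} [AddCommMonoid R] {h : ℤ} {k : ℕ} (hk : 0 < k)
    (hc : IsCoprime h (k : ℤ)) (f : ℤ → R) :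
    ∑ j ∈ Finset.range k, f (h * j % k) = ∑ j ∈ Finset.range k, f (j : ℤ) := by
  have hk' : (0 : ℤ) < k := by exact_mod_cast hk
  set g : ℕ → ℕ := fun j => (h * j % k).toNat with hg
  have hgc : ∀ j, ((g j : ℕ) : ℤ) = h * j % k := fun j =>
    Int.toNat_of_nonneg (Int.emod_nonneg _ hk'.ne')
  have hinj : Set.InjOn g (Finset.range k : Finset ℕ) := by
    intro a ha b hb hab
    have h1 : h * a % k = h * b % k := by rw [← hgc, ← hgc, hab]
    have h2 : (k : ℤ) ∣ h * (b - a) := by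
      rw [mul_sub]
      exact Int.ModEq.dvd h1
    have h3 : (k : ℤ) ∣ (b : ℤ) - a := hc.symm.dvd_of_dvd_mul_left h2
    have h4 : a ≡ b [MOD k] := (Nat.modEq_iff_dvd).mpr h3
    have ha' := Finset.mem_range.mp (Finset.mem_coe.mp ha)
    have hb' := Finset.mem_range.mp (Finset.mem_coe.mp hb)
    exact Nat.ModEq.eq_of_lt_of_lt h4 ha' hb'
  have himg : (Finset.range k).image g = Finset.range k := by
    apply Finset.eq_of_subset_of_card_le
    · intro x hx
      obtain ⟨j, -, rfl⟩ := Finset.mem_image.mp hx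
      have := Int.emod_lt_of_pos (h * j) hk'
      rw [← hgc] at this
      exact Finset.mem_range.mpr (by exact_mod_cast this)
    · rw [Finset.card_image_of_injOn hinj]
  conv_rhs => rw [← himg, Finset.sum_image hinj]
  exact Finset.sum_congr rfl fun j _ => by rw [hgc]

theorem two_mul_sum_range_cast (k : ℕ) :
    2 * ∑ j ∈ Finset.range k, (j : ℤ) = k * (k - 1) := by
  induction k with
  | zero => simp
  | succ n ih => rw [Finset.sum_range_succ, mul_add, ih]; push_cast; ring

theorem six_mul_sum_range_sq (k : ℕ) :
    6 * ∑ j ∈ Finset.range k, (j : ℤ) ^ 2 = k * (k - 1) * (2 * k - 1) := by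
  induction k with
  | zero => simp
  | succ n ih => rw [Finset.sum_range_succ, mul_add, ih]; push_cast; ring

/-- The integer `12 k s(h, k)`, for coprime `h` and `k`. -/
def dedekindNum (h : ℤ) (k : ℕ) : ℤ :=
  2 * h * (k - 1) * (2 * k - 1) - 12 * ∑ j ∈ Finset.range k, (j : ℤ) * (h * j / k) -
    3 * k * (k - 1)

theorem sawtooth_intCast_div (a : ℤ) {k : ℕ} (hk : 0 < k) :
    sawtooth ((a : ℚ) / k) = if a % k = 0 then 0 else ((a % k : ℤ) : ℚ) / k - 1 / 2 := by
  have hk' : (k : ℚ) ≠ 0 := by positivity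
  have hfl : ⌊(a : ℚ) / k⌋ = a / k := by
    exact_mod_cast Rat.floor_intCast_div_natCast a k
  have hfr : (a : ℚ) / k - ((⌊(a : ℚ) / k⌋ : ℤ) : ℚ) = ((a % k : ℤ) : ℚ) / k := by
    rw [hfl, Int.emod_def]
    push_cast
    field_simp
  have hfr' : Int.fract ((a : ℚ) / k) = ((a % k : ℤ) : ℚ) / k := by
    rw [← hfr]; rfl
  unfold sawtooth
  rw [hfr', hfr]
  have : ((a % k : ℤ) : ℚ) / k = 0 ↔ a % k = 0 := by
    rw [div_eq_zero_iff]
    simp [hk.ne']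
  simp only [this]

theorem sawtooth_neg (x : ℚ) : sawtooth (-x) = -sawtooth x := by
  unfold sawtooth
  by_cases hx : Int.fract x = 0
  · simp [hx, Int.fract_neg_eq_zero]
  · have h1 : Int.fract (-x) ≠ 0 := by rwa [Ne, Int.fract_neg_eq_zero]
    have h2 := Int.fract_neg hx
    rw [if_neg hx, if_neg h1]
    unfold Int.fract at h2
    linarith

theorem dedekindSum_neg (h : ℤ) (k : ℕ) : dedekindSum (-h) k = -dedekindSum h k := by
  unfold dedekindSum
  rw [← Finset.sum_neg_distrib]
  refine Finset.sum_congr rfl fun j _ => ?_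
  rw [← mul_neg, ← sawtooth_neg]
  congr 2
  push_cast
  ring

theorem emod_mul_natCast_eq_zero_iff {h : ℤ} {k : ℕ} (hc : IsCoprime h (k : ℤ)) {j : ℕ}
    (hj : j < k) : h * j % k = 0 ↔ j = 0 := by
  constructor
  · intro h0
    have h1 : (k : ℤ) ∣ j := hc.symm.dvd_of_dvd_mul_left (Int.dvd_of_emod_eq_zero h0)
    exact Nat.eq_zero_of_dvd_of_lt (by exact_mod_cast h1) hj
  · rintro rfl; simp

theorem twelve_mul_dedekindSum {h : ℤ} {k : ℕ} (hk : 0 < k) (hc : IsCoprime h (k : ℤ)) :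
    12 * (k : ℚ) * dedekindSum h k = dedekindNum h k := by
  have hk' : (k : ℚ) ≠ 0 := by positivity
  have hterm : ∀ j ∈ Finset.range k,
      sawtooth ((j : ℚ) / (k : ℚ)) * sawtooth ((h : ℚ) * (j : ℚ) / (k : ℚ)) =
        -- The sawtooth vanishes at integers, while the linear formula gives `-1/2`; by coprimality
        -- this happens only at `j = 0`, whence the correction `(-1/2)² = 1/4`.
        ((j : ℚ) / k - 1 / 2) * (((h * j % k : ℤ) : ℚ) / k - 1 / 2) - if j = 0 then 1 / 4 else 0 := by
    intro j hj
    have hj' := Finset.mem_range.mp hj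
    have e1 := sawtooth_intCast_div (j : ℤ) hk
    have e2 := sawtooth_intCast_div (h * j : ℤ) hk
    have e3 : ((j : ℤ) % k) = j := Int.emod_eq_of_lt (by positivity) (by exact_mod_cast hj')
    push_cast at e1 e2
    simp only [e1, e2, emod_mul_natCast_eq_zero_iff hc hj', e3]
    by_cases h0 : j = 0
    · subst h0; norm_num
    · simp [h0]
  have hs1 := two_mul_sum_range_cast k
  have hs2 := six_mul_sum_range_sq k
  have hs3 := sum_range_mul_emod hk hc (fun x => (x : ℚ))
  have hp : ∑ j ∈ Finset.range k, (j : ℤ) * (h * j % k) =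
      h * ∑ j ∈ Finset.range k, (j : ℤ) ^ 2 -
        k * ∑ j ∈ Finset.range k, (j : ℤ) * (h * j / k) := by
    rw [Finset.mul_sum, Finset.mul_sum, ← Finset.sum_sub_distrib]
    refine Finset.sum_congr rfl fun j _ => ?_
    rw [Int.emod_def]; ring
  unfold dedekindSum
  rw [Finset.sum_congr rfl hterm, Finset.sum_sub_distrib]
  have hz : ∑ j ∈ Finset.range k, (if j = 0 then (1 / 4 : ℚ) else 0) = 1 / 4 := by
    rw [Finset.sum_ite_eq' (Finset.range k) 0]
    simp [hk]
  have hexp : ∑ j ∈ Finset.range k,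
      ((j : ℚ) / k - 1 / 2) * (((h * j % k : ℤ) : ℚ) / k - 1 / 2) =
      (∑ j ∈ Finset.range k, (j : ℚ) * ((h * j % k : ℤ) : ℚ)) / k ^ 2
        - (∑ j ∈ Finset.range k, (j : ℚ)) / (2 * k)
        - (∑ j ∈ Finset.range k, ((h * j % k : ℤ) : ℚ)) / (2 * k) + k / 4 := by
    have : (k : ℚ) / 4 = ∑ j ∈ Finset.range k, (1 / 4 : ℚ) := by simp; ring
    rw [this, Finset.sum_div, Finset.sum_div, Finset.sum_div, ← Finset.sum_sub_distrib,
      ← Finset.sum_sub_distrib, ← Finset.sum_add_distrib]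
    refine Finset.sum_congr rfl fun j _ => ?_
    field_simp
    ring
  rw [hz, hexp, hs3]
  have hs1' : 2 * ∑ j ∈ Finset.range k, (j : ℚ) = k * (k - 1) := by
    have := congrArg (Int.cast : ℤ → ℚ) hs1
    push_cast at this
    exact this
  have hs2' : 6 * ∑ j ∈ Finset.range k, (j : ℚ) ^ 2 = k * (k - 1) * (2 * k - 1) := by
    have := congrArg (Int.cast : ℤ → ℚ) hs2
    push_cast at this
    exact this
  have hp' : ∑ j ∈ Finset.range k, (j : ℚ) * ((h * j % k : ℤ) : ℚ) =
      h * ∑ j ∈ Finset.range k, (j : ℚ) ^ 2 -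
        k * ∑ j ∈ Finset.range k, (j : ℚ) * ((h * j / k : ℤ) : ℚ) := by exact_mod_cast hp
  rw [hp']
  unfold dedekindNum
  push_cast
  have e1 : ∑ j ∈ Finset.range k, (j : ℚ) = k * (k - 1) / 2 := by linarith
  have e2 : ∑ j ∈ Finset.range k, (j : ℚ) ^ 2 = k * (k - 1) * (2 * k - 1) / 6 := by linarith
  rw [e1, e2]
  field_simp
  ring

theorem dedekindNum_neg {h : ℤ} {k : ℕ} (hk : 0 < k) (hc : IsCoprime h (k : ℤ)) :
    dedekindNum (-h) k = -dedekindNum h k := by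
  have h1 := twelve_mul_dedekindSum hk hc
  have h2 := twelve_mul_dedekindSum hk hc.neg_left
  rw [dedekindSum_neg] at h2
  have : (dedekindNum (-h) k : ℚ) = -dedekindNum h k := by rw [← h2, ← h1]; ring
  exact_mod_cast this

theorem dedekindNum_add_mul (h c : ℤ) {k : ℕ} (hk : 0 < k) :
    dedekindNum (h + k * c) k = dedekindNum h k := by
  have hk' : (k : ℤ) ≠ 0 := by positivity
  have : ∀ j ∈ Finset.range k, (j : ℤ) * ((h + k * c) * j / k) =
      (j : ℤ) * (h * j / k) + c * (j : ℤ) ^ 2 := by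
    intro j _
    rw [show (h + k * c) * (j : ℤ) = h * j + (c * j) * k by ring, Int.add_mul_ediv_right _ _ hk']
    ring
  unfold dedekindNum
  rw [Finset.sum_congr rfl this, Finset.sum_add_distrib, ← Finset.mul_sum]
  linear_combination (-2 * c) * six_mul_sum_range_sq k

theorem dedekindNum_emod (h : ℤ) {k : ℕ} (hk : 0 < k) :
    dedekindNum (h % k) k = dedekindNum h k := by
  conv_rhs => rw [← Int.emod_add_mul_ediv h k]
  rw [dedekindNum_add_mul _ _ hk]

/-- The residues `h j % k` permute `0, …, k - 1`, so their squares have the same sum as the `j²`.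
Expanding `(h j - k ⌊h j / k⌋)²` trades the mixed sum in `D` for a sum of squared floors, whose
coefficient is divisible by `k`. -/
theorem mul_dedekindNum {h : ℤ} {k : ℕ} (hk : 0 < k) (hc : IsCoprime h (k : ℤ)) :
    h * dedekindNum h k = (h ^ 2 + 1) * (k - 1) * (2 * k - 1) -
      6 * k * ∑ j ∈ Finset.range k, (h * j / k) ^ 2 - 3 * h * k * (k - 1) := by
  have hk' : (k : ℤ) ≠ 0 := by positivity
  have h1 := sum_range_mul_emod hk hc (fun x => x ^ 2)
  have h2 : ∑ j ∈ Finset.range k, (h * j % k) ^ 2 =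
      h ^ 2 * ∑ j ∈ Finset.range k, (j : ℤ) ^ 2
        - 2 * h * k * ∑ j ∈ Finset.range k, (j : ℤ) * (h * j / k)
        + k ^ 2 * ∑ j ∈ Finset.range k, (h * j / k) ^ 2 := by
    rw [Finset.mul_sum, Finset.mul_sum, Finset.mul_sum, ← Finset.sum_sub_distrib,
      ← Finset.sum_add_distrib]
    refine Finset.sum_congr rfl fun j _ => ?_
    rw [Int.emod_def]; ring
  rw [h2] at h1
  have h3 := six_mul_sum_range_sq k
  unfold dedekindNum
  apply mul_left_cancel₀ hk'
  linear_combination 6 * h1 - (h ^ 2 - 1) * h3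

theorem mul_dedekindNum_modEq {h : ℤ} {k : ℕ} (hk : 0 < k) (hc : IsCoprime h (k : ℤ)) :
    h * dedekindNum h k ≡ h ^ 2 + 1 [ZMOD k] := by
  rw [mul_dedekindNum hk hc]
  refine (Int.modEq_iff_dvd.mpr ⟨-((h ^ 2 + 1) * (2 * k - 3)) +
    6 * ∑ j ∈ Finset.range k, (h * j / k) ^ 2 + 3 * h * (k - 1), ?_⟩)
  ring

theorem mul_dedekindNum_modEq_three_mul {h : ℤ} {k : ℕ} (hk : 0 < k)
    (hc : IsCoprime h (k : ℤ)) (h3 : 3 ∣ k) :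
    h * dedekindNum h k ≡ h ^ 2 + 1 [ZMOD 3 * k] := by
  obtain ⟨l, hl⟩ := h3
  have hl' : (k : ℤ) = 3 * l := by exact_mod_cast hl
  rw [mul_dedekindNum hk hc]
  refine (Int.modEq_iff_dvd.mpr ⟨-((h ^ 2 + 1) * (2 * l - 1)) +
    2 * ∑ j ∈ Finset.range k, (h * j / k) ^ 2 + h * (k - 1), ?_⟩)
  linear_combination (-2 * k * (h ^ 2 + 1)) * hl'

theorem three_dvd_dedekindNum (h : ℤ) {k : ℕ} (h3 : ¬ 3 ∣ k) : 3 ∣ dedekindNum h k := by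
  have h1 : (3 : ℤ) ∣ ((k : ℤ) - 1) * (2 * k - 1) := by
    have : (k : ℤ) % 3 = 1 ∨ (k : ℤ) % 3 = 2 := by omega
    rcases this with h | h
    · exact Dvd.dvd.mul_right (by omega) _
    · exact Dvd.dvd.mul_left (by omega) _
  obtain ⟨c, hc⟩ := h1
  refine ⟨2 * h * c - 4 * ∑ j ∈ Finset.range k, (j : ℤ) * (h * j / k) - k * (k - 1), ?_⟩
  unfold dedekindNum
  linear_combination 2 * h * hc

/-! ### Reciprocity -/

theorem card_filter_mul_le {h k : ℕ} (hc : Nat.Coprime h k) {i : ℕ} (hi : i < h) :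
    (((Finset.range k).filter (fun j => k * i ≤ h * j)).card : ℤ) =
      k - 1 - ((k * i / h : ℕ) : ℤ) + if i = 0 then 1 else 0 := by
  have hh : 0 < h := by omega
  by_cases h0 : i = 0
  · subst h0; simp
  · have h1 : (Finset.range k).filter (fun j => k * i ≤ h * j) = Finset.Ico (k * i / h + 1) k := by
      ext j
      simp only [Finset.mem_filter, Finset.mem_range, Finset.mem_Ico, Nat.succ_le_iff,
        Nat.div_lt_iff_lt_mul hh]
      rw [and_comm, and_congr_left_iff]
      intro hj
      rw [mul_comm j h]
      -- No lattice point with `0 < i < h` lies on the line `k i = h j`, so `≤` and `<` agree.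
      refine ⟨fun hle => lt_of_le_of_ne hle fun he => ?_, le_of_lt⟩
      have h2 : h ∣ i := hc.dvd_of_dvd_mul_left ⟨j, he⟩
      exact h0 (Nat.eq_zero_of_dvd_of_lt h2 hi)
    rw [h1, Nat.card_Ico]
    rcases Nat.eq_zero_or_pos k with rfl | hk
    · simp at hc; omega
    · have h3 : k * i / h < k := by
        rw [Nat.div_lt_iff_lt_mul hh]; exact Nat.mul_lt_mul_of_pos_left hi hk
      rw [Nat.cast_sub (by omega)]
      simp [h0]; ring

theorem sum_filter_two_mul_sub_one {h n : ℕ} (hn : n < h) :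
    ∑ i ∈ (Finset.range h).filter (fun i => i ≤ n), (2 * (i : ℤ) - 1) = (n : ℤ) ^ 2 - 1 := by
  have h1 : (Finset.range h).filter (fun i => i ≤ n) = Finset.range (n + 1) := by
    ext i; simp; omega
  rw [h1, Finset.sum_sub_distrib, ← Finset.mul_sum, two_mul_sum_range_cast]
  simp; ring

theorem two_mul_sum_ediv {h k : ℕ} (hk : 0 < k) (hc : Nat.Coprime h k) :
    2 * ∑ j ∈ Finset.range k, ((h : ℤ) * j / k) = (h - 1) * (k - 1) := by
  have hk' : (k : ℤ) ≠ 0 := by positivity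
  have h1 := sum_range_mul_emod hk (Nat.isCoprime_iff_coprime.mpr hc) (fun x => x)
  have h2 : ∑ j ∈ Finset.range k, ((h : ℤ) * j % k) =
      h * ∑ j ∈ Finset.range k, (j : ℤ) - k * ∑ j ∈ Finset.range k, ((h : ℤ) * j / k) := by
    rw [Finset.mul_sum, Finset.mul_sum, ← Finset.sum_sub_distrib]
    exact Finset.sum_congr rfl fun j _ => Int.emod_def _ _
  rw [h2] at h1
  apply mul_left_cancel₀ hk'
  linear_combination (-2) * h1 + (h - 1) * two_mul_sum_range_cast k

/-- A square is a sum of odd numbers `2 i - 1`; writing each `⌊h j / k⌋²` this way and exchanging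
summations counts the same lattice points by columns instead of rows. This is the source of
reciprocity. -/
theorem sum_ediv_sq {h k : ℕ} (hh : 0 < h) (hk : 0 < k) (hc : Nat.Coprime h k) :
    2 * ∑ j ∈ Finset.range k, ((h : ℤ) * j / k) ^ 2 =
      2 * (h - 1) ^ 2 * (k - 1) + (h - 1) * (k - 1) -
        4 * ∑ i ∈ Finset.range h, (i : ℤ) * ((k : ℤ) * i / h) := by
  have h1 : ∀ j ∈ Finset.range k, ((h : ℤ) * j / k) ^ 2 =
      -- The leading `1` cancels the term `-1` at `i = 0`.
      1 + ∑ i ∈ Finset.range h, if k * i ≤ h * j then (2 * (i : ℤ) - 1) else 0 := by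
    intro j hj
    have hj' := Finset.mem_range.mp hj
    have h2 : h * j / k < h := by
      rw [Nat.div_lt_iff_lt_mul hk]; exact Nat.mul_lt_mul_of_pos_left hj' hh
    have h3 := sum_filter_two_mul_sub_one h2
    rw [← Finset.sum_filter]
    have h4 : (Finset.range h).filter (fun i => k * i ≤ h * j) =
        (Finset.range h).filter (fun i => i ≤ h * j / k) := by
      refine Finset.filter_congr fun i _ => ?_
      rw [Nat.le_div_iff_mul_le hk, mul_comm]
    rw [h4, h3]
    push_cast
    ring
  rw [Finset.sum_congr rfl h1, Finset.sum_add_distrib, Finset.sum_comm]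
  have h5 : ∀ i ∈ Finset.range h,
      (∑ j ∈ Finset.range k, if k * i ≤ h * j then (2 * (i : ℤ) - 1) else 0) =
        2 * (k - 1) * i - (k - 1) - 2 * ((i : ℤ) * ((k : ℤ) * i / h)) + (k : ℤ) * i / h +
          if i = 0 then -1 else 0 := by
    intro i hi
    rw [← Finset.sum_filter, Finset.sum_const, nsmul_eq_mul,
      card_filter_mul_le hc (Finset.mem_range.mp hi)]
    push_cast
    by_cases h0 : i = 0
    · subst h0; simp; ring
    · simp only [h0, if_false]; ring
  rw [Finset.sum_congr rfl h5, Finset.sum_add_distrib, Finset.sum_add_distrib,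
    Finset.sum_sub_distrib, Finset.sum_sub_distrib, ← Finset.mul_sum, ← Finset.mul_sum,
    Finset.sum_ite_eq' (Finset.range h) 0]
  simp only [Finset.sum_const, Finset.card_range, nsmul_eq_mul, Finset.mem_range, hh, if_true,
    mul_one]
  linear_combination 2 * (k - 1) * two_mul_sum_range_cast h + two_mul_sum_ediv hh hc.symm

theorem dedekindNum_reciprocity {h k : ℕ} (hh : 0 < h) (hk : 0 < k) (hc : Nat.Coprime h k) :
    h * dedekindNum h k + k * dedekindNum k h = (h : ℤ) ^ 2 + k ^ 2 + 1 - 3 * h * k := by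
  rw [mul_dedekindNum hk (Nat.isCoprime_iff_coprime.mpr hc)]
  have := sum_ediv_sq hh hk hc
  unfold dedekindNum
  linear_combination (-3 * (k : ℤ)) * this

theorem jacobiSym_eq_one_or_neg_one {a : ℤ} {b : ℕ} (h : IsCoprime a (b : ℤ)) :
    jacobiSym a b = 1 ∨ jacobiSym a b = -1 :=
  jacobiSym.eq_one_or_neg_one (Int.isCoprime_iff_gcd_eq_one.mp h)

/-! ### Congruences modulo powers of two -/

theorem dedekindNum_modEq_eight_of_reciprocal {h k : ℕ} (hh : Odd h) (hk : Odd k)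
    (hc : Nat.Coprime h k)
    (hD : dedekindNum k h ≡ h + 1 - 2 * jacobiSym k h [ZMOD 8]) :
    dedekindNum h k ≡ k + 1 - 2 * jacobiSym h k [ZMOD 8] := by
  have hrec := dedekindNum_reciprocity hh.pos hk.pos hc
  have hJ := jacobiSym_eq_one_or_neg_one (Nat.isCoprime_iff_coprime.mpr hc.symm)
  -- Here `a`, `b`, `J` are the classes of `h`, `k`, `(k | h)`. The relation `a * a = 1` permits
  -- division by `h` in Dedekind reciprocity, and the `if` is the sign of quadratic reciprocity: 3
  -- and 7 are the classes that are 3 modulo 4.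
  have key : ∀ a b : ZMod 8, (a = 1 ∨ a = 3 ∨ a = 5 ∨ a = 7) → (b = 1 ∨ b = 3 ∨ b = 5 ∨ b = 7) →
      ∀ J : ZMod 8, (J = 1 ∨ J = -1) → a * a = 1 ∧
      a * (a ^ 2 + b ^ 2 + 1 - 3 * a * b - b * (a + 1 - 2 * J)) =
        b + 1 - 2 * (if (a = 3 ∨ a = 7) ∧ (b = 3 ∨ b = 7) then -J else J) := by
    decide
  have hres : ∀ n : ℕ, Odd n → ((n : ZMod 8) = 1 ∧ n % 4 = 1) ∨ ((n : ZMod 8) = 3 ∧ n % 4 = 3) ∨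
      ((n : ZMod 8) = 5 ∧ n % 4 = 1) ∨ ((n : ZMod 8) = 7 ∧ n % 4 = 3) := by
    intro n hn
    have e : (n : ZMod 8) = ((n % 8 : ℕ) : ZMod 8) := by simp
    have : n % 8 = 1 ∨ n % 8 = 3 ∨ n % 8 = 5 ∨ n % 8 = 7 := by
      have := Nat.odd_iff.mp hn; omega
    rcases this with h | h | h | h
    · exact Or.inl ⟨by rw [e, h]; rfl, by omega⟩
    · exact Or.inr (Or.inl ⟨by rw [e, h]; rfl, by omega⟩)
    · exact Or.inr (Or.inr (Or.inl ⟨by rw [e, h]; rfl, by omega⟩))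
    · exact Or.inr (Or.inr (Or.inr ⟨by rw [e, h]; rfl, by omega⟩))
  have hJ' : jacobiSym h k = if ((h : ZMod 8) = 3 ∨ (h : ZMod 8) = 7) ∧
      ((k : ZMod 8) = 3 ∨ (k : ZMod 8) = 7) then -jacobiSym k h else jacobiSym k h := by
    have n1 : ¬ ((1 : ZMod 8) = 3 ∨ (1 : ZMod 8) = 7) := by decide
    have n5 : ¬ ((5 : ZMod 8) = 3 ∨ (5 : ZMod 8) = 7) := by decide
    have r1 : h % 4 = 1 → jacobiSym h k = jacobiSym k h := fun e =>
      jacobiSym.quadratic_reciprocity_one_mod_four e hk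
    have r2 : k % 4 = 1 → jacobiSym h k = jacobiSym k h := fun e =>
      (jacobiSym.quadratic_reciprocity_one_mod_four e hh).symm
    have r3 : h % 4 = 3 → k % 4 = 3 → jacobiSym h k = -jacobiSym k h :=
      jacobiSym.quadratic_reciprocity_three_mod_four
    rcases hres h hh with ⟨e1, e2⟩ | ⟨e1, e2⟩ | ⟨e1, e2⟩ | ⟨e1, e2⟩ <;>
    rcases hres k hk with ⟨f1, f2⟩ | ⟨f1, f2⟩ | ⟨f1, f2⟩ | ⟨f1, f2⟩ <;>
    simp only [e1, f1, n1, n5, and_self, and_false, false_and, if_false] <;>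
    first
      | exact r1 e2
      | exact r2 f2
      | simpa using r3 e2 f2
  obtain ⟨k1, k2⟩ := key h k (by have := hres h hh; tauto) (by have := hres k hk; tauto)
    (jacobiSym k h : ℤ) (by rcases hJ with e | e <;> simp [e])
  have hD' := (ZMod.intCast_eq_intCast_iff _ _ 8).mpr hD
  have hrec' := congrArg (Int.cast : ℤ → ZMod 8) hrec
  push_cast at hD' hrec'
  rw [hD'] at hrec'
  refine (ZMod.intCast_eq_intCast_iff _ _ 8).mp ?_
  rw [hJ']
  push_cast [apply_ite (Int.cast : ℤ → ZMod 8)]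
  rw [← k2, ← hrec']
  linear_combination (-(dedekindNum h k : ZMod 8)) * k1

/-- A Euclidean descent: reduce `h` to its residue `r` modulo `k` and exchange the arguments. The
exchange needs both to be odd, so an even `r` is replaced by `k - r`, using that `D` is odd in `h`.
-/
theorem dedekindNum_modEq_eight {k : ℕ} (hk : Odd k) :
    ∀ {h : ℤ}, IsCoprime h (k : ℤ) →
      dedekindNum h k ≡ k + 1 - 2 * jacobiSym h k [ZMOD 8] := by
  induction k using Nat.strong_induction_on with
  | _ k ih =>
    intro h hc
    have hkpos := hk.pos
    have hkpos' : (0 : ℤ) < k := by exact_mod_cast hkpos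
    rcases Nat.lt_or_ge 1 k with hk1 | hk1
    swap
    · have : k = 1 := by omega
      subst this
      simp [dedekindNum, jacobiSym.one_right]
    have hcr : IsCoprime (h % k) (k : ℤ) := by
      have e : h = h % k + k * (h / k) := (Int.emod_add_mul_ediv h k).symm
      rw [e] at hc
      exact IsCoprime.of_add_mul_left_left hc
    have hr0 := Int.emod_nonneg h hkpos'.ne'
    have hr1 := Int.emod_lt_of_pos h hkpos'
    rw [← dedekindNum_emod h hkpos, jacobiSym.mod_left]
    obtain ⟨r, hr⟩ := Int.eq_ofNat_of_zero_le hr0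
    rw [hr] at hcr hr1 ⊢
    have hr1' : r < k := by exact_mod_cast hr1
    have hcn : Nat.Coprime r k := Nat.isCoprime_iff_coprime.mp hcr
    rcases Nat.even_or_odd r with hre | hro
    · have hso : Odd (k - r) := Nat.Odd.sub_even hr1'.le hk hre
      have hcn' : Nat.Coprime (k - r) k := by
        rw [Nat.coprime_self_sub_left hr1'.le]; exact hcn
      have hrpos : 0 < r := by
        rcases Nat.eq_zero_or_pos r with h0 | h0
        · subst h0; simp at hcn; omega
        · exact h0
      have hs := dedekindNum_modEq_eight_of_reciprocal hso hk hcn'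
        (ih (k - r) (by omega) hso (Nat.isCoprime_iff_coprime.mpr hcn'.symm))
      have e1 : ((k - r : ℕ) : ℤ) = -(r : ℤ) + k * 1 := by rw [Nat.cast_sub hr1'.le]; ring
      have e2 : jacobiSym (-(r : ℤ) + k * 1) k = ZMod.χ₄ k * jacobiSym r k := by
        rw [← jacobiSym.neg _ hk, jacobiSym.mod_left, Int.add_mul_emod_self_left,
          ← jacobiSym.mod_left]
      rw [e1, e2, dedekindNum_add_mul _ _ hkpos, dedekindNum_neg hkpos hcr,
        ZMod.χ₄_nat_eq_if_mod_four] at hs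
      have hkodd := Nat.odd_iff.mp hk
      have hJ := jacobiSym_eq_one_or_neg_one hcr
      unfold Int.ModEq at hs ⊢
      rw [if_neg (by omega)] at hs
      rcases hJ with e | e <;> rw [e] at hs ⊢ <;> split_ifs at hs <;> omega
    · exact dedekindNum_modEq_eight_of_reciprocal hro hk hcn
        (ih r hr1' hro (Nat.isCoprime_iff_coprime.mpr hcn.symm))

theorem mul_dedekindNum_modEq_eight_mul {h k : ℕ} (hh : Odd h) (hk : 0 < k)
    (hc : Nat.Coprime h k) :
    h * dedekindNum h k ≡ (h : ℤ) ^ 2 + k ^ 2 + 3 * k + 1 + 2 * k * jacobiSym k h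
      [ZMOD 8 * k] := by
  have hrec := dedekindNum_reciprocity hh.pos hk hc
  obtain ⟨c, hc'⟩ :=
    (dedekindNum_modEq_eight hh (Nat.isCoprime_iff_coprime.mpr hc.symm)).dvd
  obtain ⟨a, ha⟩ := hh
  have ha' : (h : ℤ) = 2 * a + 1 := by exact_mod_cast ha
  -- Reciprocity yields `-4 h k - k` in place of `3 k`; as `h = 2 a + 1`, the difference is `-8 k (a
  -- + 1)`.
  refine Int.modEq_iff_dvd.mpr ⟨a + 1 - c, ?_⟩
  linear_combination (-1) * hrec - k * hc' + 4 * k * ha'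

/-! ### The multiplier of a single eta function -/

/-- The part `3 K x` of `D` contributes `exp(-πi x / 4)`, which is `i ^ c` as soon as `x ≡ -2 c`
modulo 8. -/
theorem exp_dedekindSum_eq {H : ℤ} {K : ℕ} (hK : 0 < K) (hc : IsCoprime H (K : ℤ))
    {E x c : ℤ} (hE : dedekindNum H K = E + 3 * K * x) (hx : 8 ∣ x + 2 * c) :
    Complex.exp (-((Real.pi : ℂ) * Complex.I) * ((dedekindSum H K : ℚ) : ℂ)) =
      Complex.exp (-(2 * (Real.pi : ℂ) * Complex.I) * ((E : ℂ) / (24 * K))) *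
        Complex.I ^ c := by
  have hK' : (K : ℂ) ≠ 0 := by exact_mod_cast hK.ne'
  obtain ⟨y, hy⟩ := hx
  have hs : (12 * (K : ℂ)) * ((dedekindSum H K : ℚ) : ℂ) = E + 3 * K * (8 * y - 2 * c) := by
    have h1 := congrArg (Rat.cast : ℚ → ℂ) (twelve_mul_dedekindSum hK hc)
    have h2 : x = 8 * y - 2 * c := by linarith
    rw [hE, h2] at h1
    push_cast at h1
    exact h1
  have hs' : ((dedekindSum H K : ℚ) : ℂ) = (E + 3 * K * (8 * y - 2 * c)) / (12 * K) := by
    rw [← hs]; field_simp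
  have hI : Complex.I ^ c = Complex.exp (c * ((Real.pi : ℂ) / 2 * Complex.I)) := by
    rw [Complex.exp_int_mul, Complex.exp_pi_div_two_mul_I]
  rw [hI, ← Complex.exp_add, hs', Complex.exp_eq_exp_iff_exists_int]
  refine ⟨-y, ?_⟩
  push_cast
  field_simp
  ring

theorem I_zpow_mul_of_sign {j ε : ℤ} (hj : j = 1 ∨ j = -1) (hε : ε = 1 ∨ ε = -1) :
    Complex.I ^ (j * ε) = Complex.I ^ j * (ε : ℂ) := by
  rcases hj with rfl | rfl <;> rcases hε with rfl | rfl <;> simp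

theorem oddPart_odd {n : ℕ} (hn : 0 < n) : Odd (oddPart n) := by
  have : ¬ 2 ∣ oddPart n := by
    have h := Nat.not_dvd_ordCompl Nat.prime_two hn.ne'
    rwa [Nat.factorization_def _ Nat.prime_two] at h
  rw [Nat.odd_iff]; omega

theorem two_pow_mul_oddPart (n : ℕ) : 2 ^ padicValNat 2 n * oddPart n = n :=
  Nat.mul_div_cancel' pow_padicValNat_dvd

theorem oddPart_eq_self {n : ℕ} (hn : Odd n) : oddPart n = n := by
  have : ¬ 2 ∣ n := by rw [Nat.odd_iff] at hn; omega
  simp [oddPart, padicValNat.eq_zero_of_not_dvd this]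

theorem exp_dedekindSum_of_odd {H : ℤ} {K : ℕ} (hK : Odd K) (hc : IsCoprime H (K : ℤ))
    {E : ℤ} (hE : 3 * (K : ℤ) ∣ dedekindNum H K - E) (hE8 : 8 ∣ E) :
    Complex.exp (-((Real.pi : ℂ) * Complex.I) * ((dedekindSum H K : ℚ) : ℂ)) =
      Complex.exp (-(2 * (Real.pi : ℂ) * Complex.I) * ((E : ℂ) / (24 * K))) *
        Complex.I ^ (((K : ℤ) - 3) / 2 + jacobiSym (-H) K) := by
  obtain ⟨x, hx⟩ := hE
  refine exp_dedekindSum_eq hK.pos hc (x := x) (by linarith) ?_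
  have hD := dedekindNum_modEq_eight hK hc
  have hJ := jacobiSym_eq_one_or_neg_one hc
  have h2 : 2 * (((K : ℤ) - 3) / 2) = K - 3 := by
    have := Nat.odd_iff.mp hK
    omega
  rw [mul_add, h2, jacobiSym.neg _ hK, ZMod.χ₄_nat_eq_if_mod_four]
  have hKodd := Nat.odd_iff.mp hK
  rw [if_neg (by omega)]
  have hD' : 3 * (K : ℤ) * x ≡ K + 1 - 2 * jacobiSym H K [ZMOD 8] := by
    refine Int.ModEq.trans (Int.modEq_iff_dvd.mpr ?_) hD
    obtain ⟨e, he⟩ := hE8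
    exact ⟨e, by linarith⟩
  have hmod : 3 * ((K % 8 : ℕ) : ℤ) * x ≡ ((K % 8 : ℕ) : ℤ) + 1 - 2 * jacobiSym H K [ZMOD 8] := by
    have e : ((K % 8 : ℕ) : ℤ) ≡ K [ZMOD 8] := by
      push_cast; exact Int.mod_modEq _ _
    exact ((e.mul_left 3).mul_right x).trans (hD'.trans ((e.symm.add_right 1).sub_right _))
  have hK8 : K % 8 = 1 ∨ K % 8 = 3 ∨ K % 8 = 5 ∨ K % 8 = 7 := by omega
  unfold Int.ModEq at hmod
  rcases hJ with e | e <;> rcases hK8 with f | f | f | f <;> rw [e, f] at hmod <;> rw [e] <;>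
    split_ifs <;> push_cast at hmod <;> omega

/-- Modulo 4, `H` equals `χ₄(H)`. When the odd part of `K` is 3 modulo 4 this sign cancels the one
from quadratic reciprocity; when it is 1 modulo 4 it survives. The power of two in `K` contributes
`χ₈(H)` exactly when its exponent is odd. -/
theorem natCast_mul_jacobiSym_modEq {H K : ℕ} (hH : Odd H) (hK : 0 < K) :
    H * jacobiSym K H ≡ jacobiSym H (oddPart K) *
      ((if oddPart K % 4 = 1 then ZMod.χ₄ H else 1) *
        (if ¬ 2 ∣ padicValNat 2 K then ZMod.χ₈ H else 1)) [ZMOD 4] := by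
  have hKo := oddPart_odd hK
  have h1 : jacobiSym K H = ZMod.χ₈ H ^ padicValNat 2 K * jacobiSym (oddPart K) H := by
    conv_lhs => rw [← two_pow_mul_oddPart K]
    push_cast
    rw [jacobiSym.mul_left, jacobiSym.pow_left, jacobiSym.at_two hH]
  have hHodd := Nat.odd_iff.mp hH
  have h2 : ZMod.χ₈ H = 1 ∨ ZMod.χ₈ H = -1 := by
    rw [ZMod.χ₈_nat_eq_if_mod_eight]
    split_ifs <;> simp_all
  have h3 : ZMod.χ₈ H ^ padicValNat 2 K =
      if ¬ 2 ∣ padicValNat 2 K then ZMod.χ₈ H else 1 := by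
    split_ifs with hp
    · rcases h2 with e | e <;> rw [e]
      · simp
      · exact Even.neg_one_pow (even_iff_two_dvd.mpr hp)
    · rcases h2 with e | e <;> rw [e]
      · simp
      · exact Odd.neg_one_pow (Nat.odd_iff.mpr (by omega))
  have h4 : (H : ℤ) * jacobiSym (oddPart K) H ≡
      jacobiSym H (oddPart K) * (if oddPart K % 4 = 1 then ZMod.χ₄ H else 1) [ZMOD 4] := by
    have h5 : (H : ℤ) ≡ ZMod.χ₄ H [ZMOD 4] := by
      rw [ZMod.χ₄_nat_eq_if_mod_four]
      unfold Int.ModEq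
      split_ifs <;> omega
    split_ifs with hk4
    · rw [jacobiSym.quadratic_reciprocity_one_mod_four hk4 hH, mul_comm]
      exact h5.mul_left _
    · have hk4' : oddPart K % 4 = 3 := by have := Nat.odd_iff.mp hKo; omega
      have hH4 : H % 4 = 1 ∨ H % 4 = 3 := by omega
      rcases hH4 with e | e
      · rw [jacobiSym.quadratic_reciprocity_one_mod_four e hKo, mul_comm]
        have : (H : ℤ) ≡ 1 [ZMOD 4] := by unfold Int.ModEq; omega
        exact this.mul_left _
      · rw [jacobiSym.quadratic_reciprocity_three_mod_four e hk4', mul_comm]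
        have : (H : ℤ) ≡ -1 [ZMOD 4] := by unfold Int.ModEq; omega
        have := this.mul_left (jacobiSym (oddPart K) H)
        simpa using this
  rw [h1, h3]
  have := h4.mul_left (if ¬ 2 ∣ padicValNat 2 K then ZMod.χ₈ H else 1)
  convert this using 1 <;> ring

theorem exp_dedekindSum_of_even {H K : ℕ} (hK : 0 < K) (hH : Odd H)
    (hc : Nat.Coprime H K) {E c : ℤ} (hE : 3 * (oddPart K : ℤ) ∣ dedekindNum H K - E)
    (hE2 : H * E ≡ (H : ℤ) ^ 2 + K ^ 2 + 3 * K + 1 [ZMOD 2 ^ (3 + padicValNat 2 K)])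
    (hcc : H * jacobiSym K H ≡ c [ZMOD 4]) :
    Complex.exp (-((Real.pi : ℂ) * Complex.I) * ((dedekindSum H K : ℚ) : ℂ)) =
      Complex.exp (-(2 * (Real.pi : ℂ) * Complex.I) * ((E : ℂ) / (24 * K))) *
        Complex.I ^ c := by
  set l := padicValNat 2 K with hl
  set K' := oddPart K with hK'
  set J := jacobiSym K H with hJ
  have hfac : (2 : ℤ) ^ l * K' = K := by exact_mod_cast two_pow_mul_oddPart K
  have hKo := oddPart_odd hK
  have hH2 : IsCoprime (H : ℤ) 2 := by
    have := Nat.Coprime.symm (Nat.coprime_two_left.mpr hH)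
    exact_mod_cast Nat.isCoprime_iff_coprime.mpr this
  have hD := mul_dedekindNum_modEq_eight_mul hH hK hc
  have hD2 : H * (dedekindNum H K - E) ≡ 2 * K * J [ZMOD 2 ^ (3 + l)] := by
    have hD3 := hD.of_dvd (show (2 : ℤ) ^ (3 + l) ∣ 8 * K from
      ⟨K', by rw [← hfac]; ring⟩)
    have := hD3.sub hE2
    convert this using 1 <;> ring
  -- Since `2 K J` carries only `l + 1` factors of 2, `D - E` is determined up to `6 K x`, and the
  -- two remaining binary digits of the congruence fix `x` modulo 4.
  have hd1 : (2 : ℤ) ^ (l + 1) ∣ dedekindNum H K - E := by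
    have h1 : (2 : ℤ) ^ (l + 1) ∣ H * (dedekindNum H K - E) := by
      have h2 := hD2.of_dvd (show (2 : ℤ) ^ (l + 1) ∣ 2 ^ (3 + l) from pow_dvd_pow _ (by omega))
      refine (Int.ModEq.dvd_iff h2).mpr ⟨K' * J, ?_⟩
      rw [← hfac]; ring
    exact (hH2.symm.pow_left).dvd_of_dvd_mul_left h1
  have hcop : IsCoprime ((2 : ℤ) ^ (l + 1)) (3 * K') := by
    apply IsCoprime.pow_left
    have : Nat.Coprime 2 (3 * K') :=
      Nat.coprime_two_left.mpr (Odd.mul (by decide) hKo)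
    exact_mod_cast Nat.isCoprime_iff_coprime.mpr this
  obtain ⟨x, hx⟩ := hcop.mul_dvd hd1 hE
  have hx' : dedekindNum H K - E = 6 * K * x := by rw [hx, ← hfac]; ring
  refine exp_dedekindSum_eq hK (Nat.isCoprime_iff_coprime.mpr hc) (x := 2 * x)
    (by linarith) ?_
  have h4 : 3 * H * x ≡ J [ZMOD 4] := by
    obtain ⟨y, hy⟩ := hD2.dvd
    have h5 : (K' : ℤ) * (J - 3 * H * x) = 4 * y := by
      have h0 : (2 : ℤ) ^ (l + 1) ≠ 0 := by positivity
      apply mul_left_cancel₀ h0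
      rw [hx', ← hfac] at hy
      linear_combination hy
    refine Int.modEq_iff_dvd.mpr ?_
    have h6 : IsCoprime (4 : ℤ) K' := by
      have h7 : Nat.Coprime 4 K' := by
        rw [show 4 = 2 ^ 2 by norm_num]
        exact Nat.Coprime.pow_left _ (Nat.coprime_two_left.mpr hKo)
      exact_mod_cast Nat.isCoprime_iff_coprime.mpr h7
    exact h6.dvd_of_dvd_mul_left ⟨y, h5⟩
  have h5 : x + c ≡ 0 [ZMOD 4] := by
    have hHH : (H : ℤ) * H ≡ 1 [ZMOD 4] := by
      obtain ⟨a, ha⟩ := hH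
      refine Int.modEq_iff_dvd.mpr ⟨-(a * a + a), ?_⟩
      rw [ha]; push_cast; ring
    have h7 := (h4.mul_left (H : ℤ)).trans hcc
    have h8 : x + 3 * x ≡ 0 [ZMOD 4] := Int.modEq_iff_dvd.mpr ⟨-x, by ring⟩
    have h9 : 3 * x ≡ c [ZMOD 4] := by
      refine Int.ModEq.trans ?_ h7
      have := (hHH.mul_right (3 * x)).symm
      convert this using 1 <;> ring
    exact (h9.symm.add_left x).trans h8
  obtain ⟨z, hz⟩ := Int.modEq_zero_iff_dvd.mp h5
  exact ⟨z, by linarith⟩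

/-- The sign in the value of the multiplier of `η(q ^ m)`, where `K = k_m` and `μ = m_k`. -/
def etaSign (K μ : ℕ) (h : ℤ) : ℤ :=
  jacobiSym h (oddPart K) *
    ((if 2 ∣ K ∧ oddPart K % 4 = 1 then ZMod.χ₄ ((h * μ : ℤ) : ZMod 4) else 1) *
      if 2 ∣ K ∧ ¬ 2 ∣ padicValNat 2 K then ZMod.χ₈ ((h * μ : ℤ) : ZMod 8) else 1)

/-- The exponent of `i` in the value of the multiplier of `η(q ^ m)`. -/
def etaExponent (K μ : ℕ) : ℤ :=
  (if 2 ∣ K then 0 else ((K : ℤ) - 3) / 2) + jacobiSym ((-1) ^ K * (μ : ℤ)) (oddPart K)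

/-- `24 K` times the phase of the multiplier of `η(q ^ m)`. -/
def etaPhase (K μ : ℕ) (t₁ t₂ u v w h h' : ℤ) : ℤ :=
  t₁ * u * (μ * h + v * h') +
    if 2 ∣ K then t₂ * (μ * h + w * h' * ((K : ℤ) ^ 2 + 3 * K + 1)) else 0

theorem oddPart_dvd_oddPart {K k : ℕ} (h : K ∣ k) : oddPart K ∣ oddPart k := by
  have := Nat.ordCompl_dvd_ordCompl_of_dvd h 2
  rwa [Nat.factorization_def _ Nat.prime_two, Nat.factorization_def _ Nat.prime_two] at this

theorem oddPart_dvd (n : ℕ) : oddPart n ∣ n :=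
  Dvd.intro_left _ (two_pow_mul_oddPart n)

theorem χ₄_intCast_sign {n : ℤ} (hn : Odd n) :
    ZMod.χ₄ (n : ZMod 4) = 1 ∨ ZMod.χ₄ (n : ZMod 4) = -1 := by
  have := Int.odd_iff.mp hn
  rw [ZMod.χ₄_int_eq_if_mod_four]
  split_ifs <;> simp_all

theorem χ₈_intCast_sign {n : ℤ} (hn : Odd n) :
    ZMod.χ₈ (n : ZMod 8) = 1 ∨ ZMod.χ₈ (n : ZMod 8) = -1 := by
  have := Int.odd_iff.mp hn
  rw [ZMod.χ₈_int_eq_if_mod_eight]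
  split_ifs <;> simp_all

theorem etaSign_eq_one_or_neg_one {K μ : ℕ} {h : ℤ} (hh : IsCoprime h (K : ℤ))
    (hodd : 2 ∣ K → Odd (h * μ)) : etaSign K μ h = 1 ∨ etaSign K μ h = -1 := by
  have h1 := jacobiSym_eq_one_or_neg_one
    (hh.of_isCoprime_of_dvd_right (Int.natCast_dvd_natCast.mpr (oddPart_dvd K)))
  rw [← Int.isUnit_iff] at h1 ⊢
  refine h1.mul (IsUnit.mul ?_ ?_)
  · split_ifs with hK
    · exact Int.isUnit_iff.mpr (χ₄_intCast_sign (hodd hK.1))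
    · exact isUnit_one
  · split_ifs with hK
    · exact Int.isUnit_iff.mpr (χ₈_intCast_sign (hodd hK.1))
    · exact isUnit_one

section Multiplier

variable {K μ k h : ℕ} {t₁ t₂ u v w h' : ℤ}

theorem three_mul_dvd_dedekindNum_sub (hK : 0 < K) (hKk : K ∣ k) (hμ : Nat.Coprime μ K)
    (hh : Nat.Coprime h k) (hinv : (h : ℤ) * h' ≡ 1 [ZMOD k]) (h3 : 3 ∣ K → 3 * K ∣ k)
    (hu₁ : 3 ∣ K → u = 1) (hu₂ : ¬ 3 ∣ K → u ≡ 1 [ZMOD K] ∧ u ≡ 0 [ZMOD 3])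
    (hv : v * μ ≡ 1 [ZMOD ((Nat.gcd 3 K * K : ℕ) : ℤ)]) :
    3 * (K : ℤ) ∣ dedekindNum (μ * h) K - u * (μ * h + v * h') := by
  have hHK : Nat.Coprime (μ * h) K := hμ.mul_left (hh.coprime_dvd_right hKk)
  have hHK' : IsCoprime ((μ : ℤ) * h) (K : ℤ) := by
    exact_mod_cast Nat.isCoprime_iff_coprime.mpr hHK
  by_cases hK3 : 3 ∣ K
  · rw [hu₁ hK3, one_mul]
    rw [Nat.gcd_eq_left hK3] at hv
    push_cast at hv
    have hinv' := hinv.of_dvd (show (3 * (K : ℤ)) ∣ k by exact_mod_cast h3 hK3)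
    have hcop : IsCoprime (3 * (K : ℤ)) ((μ : ℤ) * h) := by
      have h3c : Nat.Coprime 3 (μ * h) := (hHK.coprime_dvd_right hK3).symm
      have := Nat.isCoprime_iff_coprime.mpr h3c
      push_cast at this
      exact this.mul_left hHK'.symm
    apply hcop.dvd_of_dvd_mul_left
    -- Multiplying by the unit `H = μ h` turns `v h'`, an inverse of `H`, into 1, so both sides
    -- become `H² + 1`.
    refine Int.ModEq.dvd (Int.ModEq.symm ?_ : (μ * h : ℤ) * (μ * h + v * h') ≡
      (μ * h) * dedekindNum (μ * h) K [ZMOD 3 * K]) |> fun e => by rwa [mul_sub]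
    refine (mul_dedekindNum_modEq_three_mul hK hHK' hK3).trans ?_
    have := ((hv.mul hinv').add_left ((μ * h : ℤ) ^ 2)).symm
    convert this using 1 <;> ring
  · obtain ⟨hu, hu3⟩ := hu₂ hK3
    have hg : Nat.gcd 3 K = 1 := (Nat.Prime.coprime_iff_not_dvd Nat.prime_three).mpr hK3
    rw [hg, one_mul] at hv
    have hinv' := hinv.of_dvd (Int.natCast_dvd_natCast.mpr hKk)
    have hcop : IsCoprime (3 : ℤ) (K : ℤ) := by
      exact_mod_cast Nat.isCoprime_iff_coprime.mpr hg
    refine hcop.mul_dvd ?_ ?_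
    · exact dvd_sub (three_dvd_dedekindNum _ hK3)
        (Dvd.dvd.mul_right (Int.modEq_zero_iff_dvd.mp hu3) _)
    · apply hHK'.symm.dvd_of_dvd_mul_left
      refine Int.ModEq.dvd (Int.ModEq.symm ?_ : (μ * h : ℤ) * (u * (μ * h + v * h')) ≡
        (μ * h) * dedekindNum (μ * h) K [ZMOD K]) |> fun e => by rwa [mul_sub]
      refine (mul_dedekindNum_modEq hK hHK').trans ?_
      have := (hu.mul ((hv.mul hinv').add_left ((μ * h : ℤ) ^ 2))).symm
      convert this using 1 <;> ring

theorem exp_dedekindSum_eq_etaSign (hk : 0 < k) (hK : 0 < K) (hKk : K ∣ k)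
    (hμ : Nat.Coprime μ K)
    (hh : Nat.Coprime h k) (hinv : (h : ℤ) * h' ≡ 1 [ZMOD k]) (h3 : 3 ∣ K → 3 * K ∣ k)
    (h8 : 2 ∣ K → 8 * K ∣ k)
    (hu₁ : 3 ∣ K → u = 1) (hu₂ : ¬ 3 ∣ K → u ≡ 1 [ZMOD K] ∧ u ≡ 0 [ZMOD 3])
    (hv : v * μ ≡ 1 [ZMOD ((Nat.gcd 3 K * K : ℕ) : ℤ)])
    (hw : 2 ∣ K → w * μ ≡ 1 [ZMOD (2 : ℤ) ^ (3 + padicValNat 2 k)])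
    (ht₁ : t₁ ≡ 1 [ZMOD ((3 * oddPart k : ℕ) : ℤ)] ∧
      t₁ ≡ 0 [ZMOD (2 : ℤ) ^ (3 + padicValNat 2 k)])
    (ht₂ : t₂ ≡ 1 [ZMOD (2 : ℤ) ^ (3 + padicValNat 2 k)] ∧
      t₂ ≡ 0 [ZMOD ((3 * oddPart k : ℕ) : ℤ)]) :
    Complex.exp (-((Real.pi : ℂ) * Complex.I) * ((dedekindSum (μ * h) K : ℚ) : ℂ)) =
      Complex.exp (-(2 * (Real.pi : ℂ) * Complex.I) *
        ((etaPhase K μ t₁ t₂ u v w h h' : ℂ) / (24 * K))) *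
        (Complex.I ^ etaExponent K μ * (etaSign K μ h : ℂ)) := by
  have hHK : Nat.Coprime (μ * h) K := hμ.mul_left (hh.coprime_dvd_right hKk)
  have hHK' : IsCoprime ((μ : ℤ) * h) (K : ℤ) := by
    exact_mod_cast Nat.isCoprime_iff_coprime.mpr hHK
  have hKo := oddPart_odd hK
  have hKo' : ((oddPart K : ℕ) : ℤ) ∣ K := Int.natCast_dvd_natCast.mpr (oddPart_dvd K)
  have hodd : 2 ∣ K → Odd (μ * h) := fun h2 =>
    Nat.coprime_two_right.mp (hHK.coprime_dvd_right h2)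
  have hμcop : IsCoprime (μ : ℤ) ((oddPart K : ℕ) : ℤ) :=
    (Nat.isCoprime_iff_coprime.mpr hμ).of_isCoprime_of_dvd_right hKo'
  have hhK : IsCoprime (h : ℤ) (K : ℤ) :=
    Nat.isCoprime_iff_coprime.mpr (hh.coprime_dvd_right hKk)
  have hsign := etaSign_eq_one_or_neg_one (μ := μ) hhK fun h2 => by
    rw [mul_comm]; exact_mod_cast hodd h2
  have hdvd : ((3 * oddPart K : ℕ) : ℤ) ∣ ((3 * oddPart k : ℕ) : ℤ) :=
    Int.natCast_dvd_natCast.mpr (Nat.mul_dvd_mul_left 3 (oddPart_dvd_oddPart hKk))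
  have hE3 : 3 * (oddPart K : ℤ) ∣
      dedekindNum (μ * h) K - etaPhase K μ t₁ t₂ u v w h h' := by
    have h1 : 3 * (oddPart K : ℤ) ∣ dedekindNum (μ * h) K - u * (μ * h + v * h') :=
      (mul_dvd_mul_left 3 hKo').trans
        (three_mul_dvd_dedekindNum_sub hK hKk hμ hh hinv h3 hu₁ hu₂ hv)
    obtain ⟨c₁, e₁⟩ := (ht₁.1.of_dvd hdvd).dvd
    obtain ⟨c₂, e₂⟩ := (ht₂.2.of_dvd hdvd).dvd
    obtain ⟨c, e⟩ := h1
    push_cast at e₁ e₂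
    unfold etaPhase
    split_ifs
    · exact ⟨c + c₁ * u * (μ * h + v * h') +
        c₂ * (μ * h + w * h' * ((K : ℤ) ^ 2 + 3 * K + 1)), by
          linear_combination e + u * (μ * h + v * h') * e₁ +
            (μ * h + w * h' * ((K : ℤ) ^ 2 + 3 * K + 1)) * e₂⟩
    · exact ⟨c + c₁ * u * (μ * h + v * h'), by
          linear_combination e + u * (μ * h + v * h') * e₁⟩
  by_cases h2 : 2 ∣ K
  · have hval : padicValNat 2 K ≤ padicValNat 2 k :=
      (padicValNat_dvd_iff_le hk.ne').mp (pow_padicValNat_dvd.trans hKk)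
    have hpow : (2 : ℤ) ^ (3 + padicValNat 2 K) ∣ 2 ^ (3 + padicValNat 2 k) :=
      pow_dvd_pow _ (by omega)
    have hpk : (2 : ℤ) ^ (3 + padicValNat 2 K) ∣ k := by
      have h9 : 2 ^ (3 + padicValNat 2 K) ∣ k := by
        rw [pow_add]
        exact (Nat.mul_dvd_mul_left (2 ^ 3) pow_padicValNat_dvd).trans (h8 h2)
      exact_mod_cast h9
    have hJ : jacobiSym μ (oddPart K) = 1 ∨ jacobiSym μ (oddPart K) = -1 :=
      jacobiSym_eq_one_or_neg_one hμcop
    have hev : (-1 : ℤ) ^ K = 1 := Even.neg_one_pow (even_iff_two_dvd.mpr h2)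
    have hexp : etaExponent K μ = jacobiSym μ (oddPart K) := by
      simp [etaExponent, h2, hev]
    rw [hexp, ← I_zpow_mul_of_sign hJ hsign]
    have hcast : ((μ : ℤ) * h) = ((μ * h : ℕ) : ℤ) := by push_cast; ring
    rw [hcast] at hE3 ⊢
    refine exp_dedekindSum_of_even hK (hodd h2) hHK hE3 ?_ ?_
    · have a1 := ht₁.2.of_dvd hpow
      have a2 := ht₂.1.of_dvd hpow
      have a3 := (hw h2).of_dvd hpow
      have a4 := hinv.of_dvd hpk
      -- Modulo this power of 2, `t₁` kills the first summand of the phase, `t₂` is 1 and `w h'`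
      -- inverts `μ h`.
      have a5 := (a1.mul_right (((μ * h : ℕ) : ℤ) * u * (μ * h + v * h'))).add
        (a2.mul (((a3.mul a4).mul_right ((K : ℤ) ^ 2 + 3 * K + 1)).add_left
          (((μ * h : ℕ) : ℤ) ^ 2)))
      unfold etaPhase
      rw [if_pos h2]
      convert a5 using 1 <;> push_cast <;> ring
    · refine (natCast_mul_jacobiSym_modEq (hodd h2) hK).trans ?_
      unfold etaSign
      have e4 : ((μ * h : ℕ) : ZMod 4) = (((h : ℤ) * μ : ℤ) : ZMod 4) := by push_cast; ring
      have e8 : ((μ * h : ℕ) : ZMod 8) = (((h : ℤ) * μ : ℤ) : ZMod 8) := by push_cast; ring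
      have ej : jacobiSym ((μ * h : ℕ) : ℤ) (oddPart K) =
          jacobiSym μ (oddPart K) * jacobiSym h (oddPart K) := by
        push_cast; rw [jacobiSym.mul_left]
      rw [e4, e8, ej]
      simp only [h2, true_and, mul_assoc]
      exact Int.ModEq.refl _
  · have hKodd : Odd K := by rw [Nat.odd_iff]; omega
    have hself := oddPart_eq_self hKodd
    have hev : (-1 : ℤ) ^ K = -1 := Odd.neg_one_pow hKodd
    rw [hself] at hE3 hμcop
    have hJ : jacobiSym (-μ) K = 1 ∨ jacobiSym (-μ) K = -1 :=
      jacobiSym_eq_one_or_neg_one hμcop.neg_left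
    have hexp : etaExponent K μ = ((K : ℤ) - 3) / 2 + jacobiSym (-μ) K := by
      simp [etaExponent, h2, hev, hself]
    have hs : etaSign K μ h = jacobiSym h K := by
      simp [etaSign, h2, hself]
    rw [hs] at hsign
    rw [hexp, hs, zpow_add₀ Complex.I_ne_zero,
      mul_assoc (Complex.I ^ (((K : ℤ) - 3) / 2)), ← I_zpow_mul_of_sign hJ hsign,
      ← zpow_add₀ Complex.I_ne_zero, ← jacobiSym.mul_left, neg_mul (μ : ℤ)]
    refine exp_dedekindSum_of_odd hKodd hHK' hE3 ?_
    have h9 : (8 : ℤ) ∣ t₁ := by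
      refine dvd_trans ?_ (Int.modEq_zero_iff_dvd.mp ht₁.2)
      exact ⟨2 ^ padicValNat 2 k, by rw [pow_add]; norm_num⟩
    unfold etaPhase
    rw [if_neg h2, add_zero, mul_assoc]
    exact h9.mul_right _

end Multiplier

/-! ### Dirichlet characters from periodic functions -/

/-- The function `f` need not vanish off the units: it is restricted to them and extended by zero,
hence agreement is claimed only at integers coprime to `k`. -/
theorem exists_dirichletCharacter {k : ℕ} (f : ℤ → ℤ) (h1 : f 1 = 1)
    (hmul : ∀ a b, f (a * b) = f a * f b) (hper : ∀ a b, a ≡ b [ZMOD k] → f a = f b) :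
    ∃ χ : DirichletCharacter ℂ k, ∀ h : ℤ, IsCoprime h (k : ℤ) → χ (h : ZMod k) = (f h : ℂ) := by
  have hcast : ∀ (x : ZMod k) (h : ℤ), (h : ZMod k) = x → f (x.cast : ℤ) = f h := fun x h hx =>
    hper _ _ ((ZMod.intCast_eq_intCast_iff _ _ k).mp (by rw [ZMod.intCast_zmod_cast, hx]))
  let g : (ZMod k)ˣ →* ℂ :=
    { toFun := fun x => (f ((x : ZMod k).cast : ℤ) : ℂ)
      map_one' := by rw [hcast _ 1 (by simp), h1]; simp
      map_mul' := fun x y => by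
        rw [hcast _ (((x : ZMod k).cast : ℤ) * ((y : ZMod k).cast : ℤ)) (by simp), hmul]
        push_cast
        rfl }
  refine ⟨MulChar.ofUnitHom g.toHomUnits, fun h hh => ?_⟩
  obtain ⟨x, hx⟩ := (ZMod.coe_int_isUnit_iff_isCoprime h k).mpr hh.symm
  rw [← hx, MulChar.ofUnitHom_coe]
  change (f ((x : ZMod k).cast : ℤ) : ℂ) = f h
  rw [hcast _ h hx.symm]

theorem chiVal_one (M : Finset ℕ) (δ : ℕ → ℤ) (k : ℕ) : chiVal M δ k 1 = 1 := by
  simp [chiVal, jacobiSym.one_left]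

theorem chiVal_mul (M : Finset ℕ) (δ : ℕ → ℤ) (k : ℕ) (a b : ℤ) :
    chiVal M δ k (a * b) = chiVal M δ k a * chiVal M δ k b := by
  simp [chiVal, jacobiSym.mul_left, Finset.prod_mul_distrib]

theorem kSub_dvd (k m : ℕ) : kSub k m ∣ k := Nat.div_dvd_of_dvd (Nat.gcd_dvd_right m k)

theorem chiVal_congr (M : Finset ℕ) (δ : ℕ → ℤ) {k : ℕ} {a b : ℤ}
    (hab : a ≡ b [ZMOD k]) : chiVal M δ k a = chiVal M δ k b := by
  refine Finset.prod_congr rfl fun m _ => ?_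
  rw [jacobiSym.mod_left a, jacobiSym.mod_left b]
  congr 1
  exact hab.of_dvd (Int.natCast_dvd_natCast.mpr ((oddPart_dvd _).trans (kSub_dvd k m)))

/-- The character modulo `8` that agrees with `h ↦ ψ(1) ψ(h)` on odd integers. -/
def rhoVal (M : Finset ℕ) (δ : ℕ → ℤ) (k : ℕ) (h : ℤ) : ℤ :=
  (∏ _m ∈ M.filter (fun m => ¬ (2 : ℤ) ∣ δ m ∧ 2 ∣ kSub k m ∧ oddPart (kSub k m) % 4 = 1),
      ZMod.χ₄ (h : ZMod 4)) *
    ∏ _m ∈ M.filter (fun m => ¬ (2 : ℤ) ∣ δ m ∧ 2 ∣ kSub k m ∧ ¬ 2 ∣ padicValNat 2 (kSub k m)),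
      ZMod.χ₈ (h : ZMod 8)

theorem rhoVal_one (M : Finset ℕ) (δ : ℕ → ℤ) (k : ℕ) : rhoVal M δ k 1 = 1 := by
  simp [rhoVal]

theorem rhoVal_mul (M : Finset ℕ) (δ : ℕ → ℤ) (k : ℕ) (a b : ℤ) :
    rhoVal M δ k (a * b) = rhoVal M δ k a * rhoVal M δ k b := by
  unfold rhoVal
  push_cast
  simp only [map_mul, Finset.prod_mul_distrib]
  ring

theorem χ₄_congr {a b : ℤ} (h : a ≡ b [ZMOD 8]) :
    ZMod.χ₄ (a : ZMod 4) = ZMod.χ₄ (b : ZMod 4) := by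
  rw [(ZMod.intCast_eq_intCast_iff a b 4).mpr (h.of_dvd (by norm_num))]

theorem χ₈_congr {a b : ℤ} (h : a ≡ b [ZMOD 8]) :
    ZMod.χ₈ (a : ZMod 8) = ZMod.χ₈ (b : ZMod 8) := by
  rw [(ZMod.intCast_eq_intCast_iff a b 8).mpr h]

/-- The congruence modulo 8 is required only if some `k_m` is even, since otherwise both products
are empty. This is what makes `χρ` periodic modulo `k` even when `8 ∤ k`. -/
theorem rhoVal_congr (M : Finset ℕ) (δ : ℕ → ℤ) {k : ℕ} {a b : ℤ}
    (hab : ∀ m ∈ M, 2 ∣ kSub k m → a ≡ b [ZMOD 8]) : rhoVal M δ k a = rhoVal M δ k b := by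
  unfold rhoVal
  congr 1
  · refine Finset.prod_congr rfl fun m hm => χ₄_congr ?_
    rw [Finset.mem_filter] at hm
    exact hab m hm.1 hm.2.2.1
  · refine Finset.prod_congr rfl fun m hm => χ₈_congr ?_
    rw [Finset.mem_filter] at hm
    exact hab m hm.1 hm.2.2.1

/-! ### The sign `ψ` in terms of `χ₄` and `χ₈` -/

theorem neg_one_zpow_sub_one_div_two {n : ℤ} (hn : Odd n) :
    (((-1 : ℤˣ) ^ ((n - 1) / 2) : ℤˣ) : ℤ) = ZMod.χ₄ (n : ZMod 4) := by
  have hn' := Int.odd_iff.mp hn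
  rw [ZMod.χ₄_int_eq_if_mod_four, if_neg (by omega)]
  split_ifs with h
  · rw [Even.neg_one_zpow (Int.even_iff.mpr (by omega))]; rfl
  · rw [Odd.neg_one_zpow (Int.odd_iff.mpr (by omega))]; rfl

theorem neg_one_zpow_sq_sub_one_div_eight {n : ℤ} (hn : Odd n) :
    (((-1 : ℤˣ) ^ ((n ^ 2 - 1) / 8) : ℤˣ) : ℤ) = ZMod.χ₈ (n : ZMod 8) := by
  have hn' := Int.odd_iff.mp hn
  rw [ZMod.χ₈_int_eq_if_mod_eight, if_neg (by omega)]
  obtain ⟨q, hq⟩ : ∃ q, n = 8 * q + n % 8 := ⟨n / 8, by omega⟩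
  have h8 : n % 8 = 1 ∨ n % 8 = 3 ∨ n % 8 = 5 ∨ n % 8 = 7 := by omega
  have key : ∀ c : ℤ, n ^ 2 - 1 = 8 * c → (n ^ 2 - 1) / 8 = c := fun c hc => by omega
  rcases h8 with h | h | h | h <;> rw [h] at hq ⊢
  · rw [key (2 * (4 * q ^ 2 + q)) (by rw [hq]; ring), Even.neg_one_zpow (even_two_mul _)]; simp
  · rw [key (2 * (4 * q ^ 2 + 3 * q) + 1) (by rw [hq]; ring),
      Odd.neg_one_zpow (odd_two_mul_add_one _)]; simp
  · rw [key (2 * (4 * q ^ 2 + 5 * q + 1) + 1) (by rw [hq]; ring),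
      Odd.neg_one_zpow (odd_two_mul_add_one _)]; simp
  · rw [key (2 * (4 * q ^ 2 + 7 * q + 3)) (by rw [hq]; ring),
      Even.neg_one_zpow (even_two_mul _)]; simp

theorem psi_eq {M : Finset ℕ} {δ : ℕ → ℤ} {k : ℕ} {h : ℤ}
    (hodd : ∀ m ∈ M, 2 ∣ kSub k m → Odd (h * mSub k m)) :
    ((psi M δ k h : ℤˣ) : ℤ) =
      (∏ m ∈ M.filter (fun m => ¬ (2 : ℤ) ∣ δ m ∧ 2 ∣ kSub k m ∧ oddPart (kSub k m) % 4 = 1),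
        ZMod.χ₄ ((h * mSub k m : ℤ) : ZMod 4)) *
      ∏ m ∈ M.filter (fun m => ¬ (2 : ℤ) ∣ δ m ∧ 2 ∣ kSub k m ∧ ¬ 2 ∣ padicValNat 2 (kSub k m)),
        ZMod.χ₈ ((h * mSub k m : ℤ) : ZMod 8) := by
  unfold psi
  rw [Units.val_mul, Units.coe_prod, Units.coe_prod]
  congr 1
  · refine Finset.prod_congr rfl fun m hm => ?_
    rw [Finset.mem_filter] at hm
    exact neg_one_zpow_sub_one_div_two (hodd m hm.1 hm.2.2.1)
  · refine Finset.prod_congr rfl fun m hm => ?_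
    rw [Finset.mem_filter] at hm
    exact neg_one_zpow_sq_sub_one_div_eight (hodd m hm.1 hm.2.2.1)

theorem mSub_coprime_kSub {k : ℕ} (hk : 0 < k) (m : ℕ) : Nat.Coprime (mSub k m) (kSub k m) :=
  Nat.coprime_div_gcd_div_gcd (Nat.gcd_pos_of_pos_right m hk)

theorem odd_mSub {k : ℕ} (hk : 0 < k) {m : ℕ} (h2 : 2 ∣ kSub k m) : Odd (mSub k m) :=
  Nat.coprime_two_right.mp ((mSub_coprime_kSub hk m).coprime_dvd_right h2)

/-- Each factor of `ψ(h)` is a character at `h m_k`; multiplying by its value at `m_k`, a sign,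
removes the `m_k`. -/
theorem psi_one_mul_psi {M : Finset ℕ} {δ : ℕ → ℤ} {k : ℕ} (hk : 0 < k) {h : ℤ}
    (hodd : ∀ m ∈ M, 2 ∣ kSub k m → Odd h) :
    ((psi M δ k 1 * psi M δ k h : ℤˣ) : ℤ) = rhoVal M δ k h := by
  have hm : ∀ m, 2 ∣ kSub k m → Odd ((mSub k m : ℕ) : ℤ) := fun m h2 =>
    by exact_mod_cast odd_mSub hk h2
  have key : ∀ x y : ℤ, (y = 1 ∨ y = -1) → y * (x * y) = x := by
    rintro x y (rfl | rfl) <;> ring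
  rw [Units.val_mul, psi_eq (fun m _ h2 => by simpa using hm m h2),
    psi_eq (fun m hmM h2 => (hodd m hmM h2).mul (hm m h2)), mul_mul_mul_comm,
    ← Finset.prod_mul_distrib, ← Finset.prod_mul_distrib]
  unfold rhoVal
  congr 1
  · refine Finset.prod_congr rfl fun m hmM => ?_
    rw [Finset.mem_filter] at hmM
    rw [one_mul, Int.cast_mul, map_mul]
    exact key _ _ (χ₄_intCast_sign (hm m hmM.2.2.1))
  · refine Finset.prod_congr rfl fun m hmM => ?_
    rw [Finset.mem_filter] at hmM
    rw [one_mul, Int.cast_mul, map_mul]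
    exact key _ _ (χ₈_intCast_sign (hm m hmM.2.2.1))

/-! ### Divisibility forced by `24 ∣ m` -/

theorem gcd_mul_kSub (k m : ℕ) : Nat.gcd m k * kSub k m = k :=
  Nat.mul_div_cancel' (Nat.gcd_dvd_right m k)

theorem gcd_mul_mSub (k m : ℕ) : Nat.gcd m k * mSub k m = m :=
  Nat.mul_div_cancel' (Nat.gcd_dvd_left m k)

theorem eight_dvd_gcd {k m : ℕ} (hk : 0 < k) (hm : 24 ∣ m) (h2 : 2 ∣ kSub k m) :
    8 ∣ Nat.gcd m k := by
  have h1 : 8 ∣ Nat.gcd m k * mSub k m := by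
    rw [gcd_mul_mSub]; exact Nat.dvd_trans (by norm_num) hm
  refine Nat.Coprime.dvd_of_dvd_mul_right ?_ h1
  rw [show 8 = 2 ^ 3 by norm_num]
  exact Nat.Coprime.pow_left _ (Nat.coprime_two_left.mpr (odd_mSub hk h2))

theorem three_dvd_gcd {k m : ℕ} (hk : 0 < k) (hm : 24 ∣ m) (h3 : 3 ∣ kSub k m) :
    3 ∣ Nat.gcd m k := by
  have h1 : 3 ∣ Nat.gcd m k * mSub k m := by
    rw [gcd_mul_mSub]; exact Nat.dvd_trans (by norm_num) hm
  exact Nat.Coprime.dvd_of_dvd_mul_right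
    ((mSub_coprime_kSub hk m).coprime_dvd_right h3).symm h1

/-! ### Assembling the multipliers over all `m` -/

theorem prod_etaSign_zpow {M : Finset ℕ} {δ : ℕ → ℤ} {k : ℕ} (hk : 0 < k) {h : ℤ}
    (hh : IsCoprime h (k : ℤ)) (hodd : ∀ m ∈ M, 2 ∣ kSub k m → Odd h) :
    ∏ m ∈ M, ((etaSign (kSub k m) (mSub k m) h : ℤ) : ℂ) ^ δ m =
      ((chiVal M δ k h * (psi M δ k h : ℤˣ) : ℤ) : ℂ) := by
  have hmodd : ∀ m ∈ M, 2 ∣ kSub k m → Odd (h * (mSub k m : ℤ)) := fun m hm h2 =>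
    (hodd m hm h2).mul (by exact_mod_cast odd_mSub hk h2)
  have hterm : ∀ m ∈ M, ((etaSign (kSub k m) (mSub k m) h : ℤ) : ℂ) ^ δ m =
      ((if ¬ (2 : ℤ) ∣ δ m then etaSign (kSub k m) (mSub k m) h else 1 : ℤ) : ℂ) := by
    intro m hm
    have hs := etaSign_eq_one_or_neg_one (μ := mSub k m)
      (hh.of_isCoprime_of_dvd_right (Int.natCast_dvd_natCast.mpr (kSub_dvd k m))) (hmodd m hm)
    by_cases h2 : (2 : ℤ) ∣ δ m
    · rw [if_neg (not_not.mpr h2)]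
      rcases hs with e | e <;> rw [e]
      · simp
      · push_cast; exact Even.neg_one_zpow (even_iff_two_dvd.mpr h2)
    · rw [if_pos h2]
      rcases hs with e | e <;> rw [e]
      · simp
      · push_cast; exact Odd.neg_one_zpow (Int.not_even_iff_odd.mp (mt even_iff_two_dvd.mp h2))
  rw [Finset.prod_congr rfl hterm, ← Int.cast_prod, psi_eq hmodd]
  unfold chiVal
  rw [Finset.prod_filter, Finset.prod_filter, Finset.prod_filter, ← Finset.prod_mul_distrib,
    ← Finset.prod_mul_distrib]
  congr 1
  refine Finset.prod_congr rfl fun m _ => ?_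
  unfold etaSign
  by_cases h2 : (2 : ℤ) ∣ δ m
  · simp [h2]
  · simp only [h2, not_false_eq_true, true_and, if_true]

theorem prod_zpow_eq_zpow_sum {ι : Type*} (s : Finset ι) {x : ℂ} (hx : x ≠ 0) (f : ι → ℤ) :
    ∏ i ∈ s, x ^ f i = x ^ ∑ i ∈ s, f i := by
  classical
  induction s using Finset.induction_on with
  | empty => simp
  | insert a s ha ih => rw [Finset.prod_insert ha, Finset.sum_insert ha, ih, zpow_add₀ hx]

theorem sum_mul_etaExponent (M : Finset ℕ) (δ : ℕ → ℤ) (k : ℕ) :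
    ∑ m ∈ M, etaExponent (kSub k m) (mSub k m) * δ m = cExp M δ k := by
  unfold cExp
  rw [Finset.sum_filter, ← Finset.sum_add_distrib]
  refine Finset.sum_congr rfl fun m _ => ?_
  unfold etaExponent
  split_ifs <;> ring

/-- The factor `gcd(m, k)` brings the phases, with denominators `24 k_m`, to the common denominator
`24 k`, and turns `m_k` back into `m`. -/
theorem sum_gcd_mul_etaPhase (M : Finset ℕ) (δ u v w : ℕ → ℤ) (k : ℕ) (t₁ t₂ h h' : ℤ) :
    ∑ m ∈ M, δ m * ((Nat.gcd m k : ℤ) *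
        etaPhase (kSub k m) (mSub k m) t₁ t₂ (u m) (v m) (w m) h h') =
      -((t₁ * aOne M δ u + t₂ * aTwo M δ k) * h + (t₁ * bOne M δ k u v + t₂ * bTwo M δ k w) * h') := by
  unfold aOne aTwo bOne bTwo
  rw [Finset.sum_filter, Finset.sum_filter]
  have : ∀ A B C D : ℤ, -((t₁ * (-A) + t₂ * (-B)) * h + (t₁ * (-C) + t₂ * (-D)) * h') =
      (A * (t₁ * h) + B * (t₂ * h)) + (C * (t₁ * h') + D * (t₂ * h')) := by intros; ring
  rw [this, Finset.sum_mul, Finset.sum_mul, Finset.sum_mul, Finset.sum_mul,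
    ← Finset.sum_add_distrib, ← Finset.sum_add_distrib, ← Finset.sum_add_distrib]
  refine Finset.sum_congr rfl fun m _ => ?_
  have hm : (m : ℤ) = Nat.gcd m k * mSub k m := by exact_mod_cast (gcd_mul_mSub k m).symm
  unfold etaPhase
  generalize (Nat.gcd m k : ℤ) = g at hm ⊢
  rw [hm]
  split_ifs <;> ring

theorem dvd_aOne {M : Finset ℕ} (hM24 : ∀ m ∈ M, 24 ∣ m) (δ u : ℕ → ℤ) : 24 ∣ aOne M δ u := by
  refine (Finset.dvd_sum fun m hm => ?_).neg_right
  exact Dvd.dvd.mul_left (by exact_mod_cast hM24 m hm) _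

theorem dvd_aTwo {M : Finset ℕ} (hM24 : ∀ m ∈ M, 24 ∣ m) (δ : ℕ → ℤ) (k : ℕ) :
    24 ∣ aTwo M δ k := by
  refine (Finset.dvd_sum fun m hm => ?_).neg_right
  exact Dvd.dvd.mul_left (by exact_mod_cast hM24 m (Finset.mem_filter.mp hm).1) _

theorem three_dvd_bOne {M : Finset ℕ} (hM24 : ∀ m ∈ M, 24 ∣ m) (δ : ℕ → ℤ) {k : ℕ} (hk : 0 < k)
    {u : ℕ → ℤ} (v : ℕ → ℤ) (hu : ∀ m ∈ M, ¬ 3 ∣ kSub k m → u m ≡ 0 [ZMOD 3]) :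
    3 ∣ bOne M δ k u v := by
  refine (Finset.dvd_sum fun m hm => ?_).neg_right
  by_cases h3 : 3 ∣ kSub k m
  · exact Dvd.dvd.mul_left (by exact_mod_cast three_dvd_gcd hk (hM24 m hm) h3) _
  · exact Dvd.dvd.mul_right (Dvd.dvd.mul_right
      (Dvd.dvd.mul_left (Int.modEq_zero_iff_dvd.mp (hu m hm h3)) _) _) _

theorem eight_dvd_bTwo {M : Finset ℕ} (hM24 : ∀ m ∈ M, 24 ∣ m) (δ : ℕ → ℤ) {k : ℕ} (hk : 0 < k)
    (w : ℕ → ℤ) : 8 ∣ bTwo M δ k w := by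
  refine (Finset.dvd_sum fun m hm => ?_).neg_right
  rw [Finset.mem_filter] at hm
  exact Dvd.dvd.mul_right (Dvd.dvd.mul_left
    (by exact_mod_cast eight_dvd_gcd hk (hM24 m hm.1) hm.2) _) _

theorem exp_hrr_term {M : Finset ℕ} {δ : ℕ → ℤ} {k h : ℕ} (hk : 0 < k)
    (hh : Nat.Coprime h k) {u v w : ℕ → ℤ} {t₁ t₂ a b h' : ℤ}
    (ha : t₁ * aOne M δ u + t₂ * aTwo M δ k = 24 * a)
    (hb : t₁ * bOne M δ k u v + t₂ * bTwo M δ k w = 24 * b)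
    (hodd : ∀ m ∈ M, 2 ∣ kSub k m → Odd (h : ℤ))
    (hterm : ∀ m ∈ M, Complex.exp (-((Real.pi : ℂ) * Complex.I) *
        ((dedekindSum ((mSub k m : ℤ) * h) (kSub k m) : ℚ) : ℂ)) =
      Complex.exp (-(2 * (Real.pi : ℂ) * Complex.I) *
        ((etaPhase (kSub k m) (mSub k m) t₁ t₂ (u m) (v m) (w m) h h' : ℂ) /
          (24 * (kSub k m : ℂ)))) *
        (Complex.I ^ etaExponent (kSub k m) (mSub k m) *
          (etaSign (kSub k m) (mSub k m) h : ℂ))) (n : ℤ) :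
    Complex.exp (-2 * (Real.pi : ℂ) * Complex.I *
      ((h : ℂ) * (n : ℂ) / (k : ℂ) +
        1 / 2 * ∑ m ∈ M, (δ m : ℂ) *
          ((dedekindSum ((mSub k m : ℤ) * (h : ℤ)) (kSub k m) : ℚ) : ℂ))) =
      Complex.I ^ cExp M δ k * (((psi M δ k 1 : ℤˣ) : ℤ) : ℂ) *
        (((chiVal M δ k h * rhoVal M δ k h : ℤ) : ℂ) *
          Complex.exp (2 * (Real.pi : ℂ) * Complex.I / (k : ℂ) *
            (((a - n : ℤ) : ℂ) * (h : ℂ) + (b : ℂ) * (h' : ℂ)))) := by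
  have hk' : (k : ℂ) ≠ 0 := by exact_mod_cast hk.ne'
  have h1 : -2 * (Real.pi : ℂ) * Complex.I *
      ((h : ℂ) * (n : ℂ) / (k : ℂ) +
        1 / 2 * ∑ m ∈ M, (δ m : ℂ) *
          ((dedekindSum ((mSub k m : ℤ) * (h : ℤ)) (kSub k m) : ℚ) : ℂ)) =
      -2 * (Real.pi : ℂ) * Complex.I * ((h : ℂ) * (n : ℂ) / (k : ℂ)) +
        ∑ m ∈ M, (δ m : ℂ) * (-((Real.pi : ℂ) * Complex.I) *
          ((dedekindSum ((mSub k m : ℤ) * (h : ℤ)) (kSub k m) : ℚ) : ℂ)) := by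
    rw [mul_add, ← mul_assoc, Finset.mul_sum]
    congr 1
    exact Finset.sum_congr rfl fun m _ => by ring
  have h2 : ∀ m ∈ M, Complex.exp ((δ m : ℂ) * (-((Real.pi : ℂ) * Complex.I) *
        ((dedekindSum ((mSub k m : ℤ) * (h : ℤ)) (kSub k m) : ℚ) : ℂ))) =
      Complex.exp (-(2 * (Real.pi : ℂ) * Complex.I) / (24 * k) *
        ((δ m * ((Nat.gcd m k : ℤ) *
          etaPhase (kSub k m) (mSub k m) t₁ t₂ (u m) (v m) (w m) h h') : ℤ) : ℂ)) *
        (Complex.I ^ (etaExponent (kSub k m) (mSub k m) * δ m) *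
          ((etaSign (kSub k m) (mSub k m) h : ℤ) : ℂ) ^ δ m) := by
    intro m hm
    rw [Complex.exp_int_mul, hterm m hm, mul_zpow, mul_zpow, ← zpow_mul, ← Complex.exp_int_mul]
    congr 2
    have hgk : (k : ℂ) = Nat.gcd m k * kSub k m := by exact_mod_cast (gcd_mul_kSub k m).symm
    have hg : ((Nat.gcd m k : ℕ) : ℂ) ≠ 0 := by
      exact_mod_cast (Nat.gcd_pos_of_pos_right m hk).ne'
    have hK : ((kSub k m : ℕ) : ℂ) ≠ 0 := by
      intro h0; rw [h0, mul_zero] at hgk; exact hk' hgk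
    push_cast
    generalize ((Nat.gcd m k : ℕ) : ℂ) = g at hgk hg ⊢
    rw [hgk]
    field_simp
  have h3 : (((psi M δ k 1 : ℤˣ) : ℤ) : ℂ) * ((chiVal M δ k h * rhoVal M δ k h : ℤ) : ℂ) =
      ((chiVal M δ k h * (psi M δ k h : ℤˣ) : ℤ) : ℂ) := by
    rw [← psi_one_mul_psi hk hodd, ← Int.cast_mul]
    congr 1
    have : ((psi M δ k 1 : ℤˣ) : ℤ) * ((psi M δ k 1 : ℤˣ) : ℤ) = 1 :=
      Int.units_coe_mul_self _
    push_cast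
    linear_combination chiVal M δ k h * (psi M δ k h : ℤˣ) * this
  rw [h1, Complex.exp_add, Complex.exp_sum, Finset.prod_congr rfl h2, Finset.prod_mul_distrib,
    Finset.prod_mul_distrib, prod_zpow_eq_zpow_sum _ Complex.I_ne_zero, sum_mul_etaExponent,
    prod_etaSign_zpow hk (Nat.isCoprime_iff_coprime.mpr hh) hodd, ← h3, ← Complex.exp_sum,
    ← Finset.mul_sum, ← Int.cast_sum, sum_gcd_mul_etaPhase, ha, hb]
  have h4 : Complex.exp (2 * (Real.pi : ℂ) * Complex.I / (k : ℂ) *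
      (((a - n : ℤ) : ℂ) * (h : ℂ) + (b : ℂ) * (h' : ℂ))) =
      Complex.exp (-2 * (Real.pi : ℂ) * Complex.I * ((h : ℂ) * (n : ℂ) / (k : ℂ))) *
      Complex.exp (-(2 * (Real.pi : ℂ) * Complex.I) / (24 * k) *
        ((-(24 * a * h + 24 * b * h') : ℤ) : ℂ)) := by
    rw [← Complex.exp_add]
    congr 1
    push_cast
    field_simp
    ring
  rw [h4]
  ring

end HRR

theorem theorem4p3
    (M : Finset ℕ) (hMpos : ∀ m ∈ M, 0 < m) (hM24 : ∀ m ∈ M, 24 ∣ m)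
    (δ : ℕ → ℤ) (k : ℕ) (hk : 0 < k)
    (u v w : ℕ → ℤ) (t₁ t₂ : ℤ)
    (hu₁ : ∀ m ∈ M, 3 ∣ HRR.kSub k m → u m = 1)
    (hu₂ : ∀ m ∈ M, ¬ 3 ∣ HRR.kSub k m →
      u m ≡ 1 [ZMOD (HRR.kSub k m : ℤ)] ∧ u m ≡ 0 [ZMOD 3])
    (hv : ∀ m ∈ M,
      v m * (HRR.mSub k m : ℤ) ≡ 1
        [ZMOD ((Nat.gcd 3 (HRR.kSub k m) * HRR.kSub k m : ℕ) : ℤ)])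
    (hw : ∀ m ∈ M, 2 ∣ HRR.kSub k m →
      w m * (HRR.mSub k m : ℤ) ≡ 1 [ZMOD (2 : ℤ) ^ (3 + padicValNat 2 k)])
    (ht₁ : t₁ ≡ 1 [ZMOD ((3 * HRR.oddPart k : ℕ) : ℤ)] ∧
      t₁ ≡ 0 [ZMOD (2 : ℤ) ^ (3 + padicValNat 2 k)])
    (ht₂ : t₂ ≡ 1 [ZMOD (2 : ℤ) ^ (3 + padicValNat 2 k)] ∧
      t₂ ≡ 0 [ZMOD ((3 * HRR.oddPart k : ℕ) : ℤ)]) :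
    -- the divisions by 24 that define `a` and `b` are exact
    24 ∣ t₁ * HRR.aOne M δ u + t₂ * HRR.aTwo M δ k ∧
    24 ∣ t₁ * HRR.bOne M δ k u v + t₂ * HRR.bTwo M δ k w ∧
    -- `χ`, `ρ` and their product `χρ` are Dirichlet characters
    ∃ (χ : DirichletCharacter ℂ k) (ρ : DirichletCharacter ℂ 8) (χρ : DirichletCharacter ℂ k),
      (∀ h : ℤ, IsCoprime h (k : ℤ) → χ (h : ZMod k) = ((HRR.chiVal M δ k h : ℤ) : ℂ)) ∧
      (∀ h : ℤ, Odd h →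
        ρ (h : ZMod 8) = (((HRR.psi M δ k 1 * HRR.psi M δ k h : ℤˣ) : ℤ) : ℂ)) ∧
      (∀ h : ℤ, IsCoprime h (2 * (k : ℤ)) → χρ (h : ZMod k) = χ (h : ZMod k) * ρ (h : ZMod 8)) ∧
      ∀ n : ℤ,
        HRR.hrrCoeff M δ k n =
          Complex.I ^ HRR.cExp M δ k * (((HRR.psi M δ k 1 : ℤˣ) : ℤ) : ℂ) *
            HRR.twistedKloosterman χρ
              ((t₁ * HRR.aOne M δ u + t₂ * HRR.aTwo M δ k) / 24 - n)
              ((t₁ * HRR.bOne M δ k u v + t₂ * HRR.bTwo M δ k w) / 24) := by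
  have h8k : ∀ m ∈ M, 2 ∣ HRR.kSub k m → 8 * HRR.kSub k m ∣ k := fun m hm h2 => by
    conv_rhs => rw [← HRR.gcd_mul_kSub k m]
    exact Nat.mul_dvd_mul_right (HRR.eight_dvd_gcd hk (hM24 m hm) h2) _
  have h3k : ∀ m ∈ M, 3 ∣ HRR.kSub k m → 3 * HRR.kSub k m ∣ k := fun m hm h3 => by
    conv_rhs => rw [← HRR.gcd_mul_kSub k m]
    exact Nat.mul_dvd_mul_right (HRR.three_dvd_gcd hk (hM24 m hm) h3) _
  have h8t₁ : (8 : ℤ) ∣ t₁ := by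
    refine dvd_trans ?_ (Int.modEq_zero_iff_dvd.mp ht₁.2)
    exact ⟨2 ^ padicValNat 2 k, by rw [pow_add]; norm_num⟩
  have h3t₂ : (3 : ℤ) ∣ t₂ := by
    refine dvd_trans ?_ (Int.modEq_zero_iff_dvd.mp ht₂.2)
    exact ⟨HRR.oddPart k, by push_cast; ring⟩
  have ha : 24 ∣ t₁ * HRR.aOne M δ u + t₂ * HRR.aTwo M δ k :=
    dvd_add ((HRR.dvd_aOne hM24 δ u).mul_left _) ((HRR.dvd_aTwo hM24 δ k).mul_left _)
  have hb : 24 ∣ t₁ * HRR.bOne M δ k u v + t₂ * HRR.bTwo M δ k w := by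
    have h1 : (8 * 3 : ℤ) ∣ t₁ * HRR.bOne M δ k u v :=
      -- Neither `b₁` nor `b₂` need be divisible by 24: `t₁` supplies the 8 missing from `b₁`, and
      -- `t₂` the 3 missing from `b₂`.
      mul_dvd_mul h8t₁ (HRR.three_dvd_bOne hM24 δ hk v fun m hm h => (hu₂ m hm h).2)
    have h2 : (3 * 8 : ℤ) ∣ t₂ * HRR.bTwo M δ k w :=
      mul_dvd_mul h3t₂ (HRR.eight_dvd_bTwo hM24 δ hk w)
    norm_num at h1 h2
    exact dvd_add h1 h2
  obtain ⟨χ, hχ⟩ := HRR.exists_dirichletCharacter (HRR.chiVal M δ k) (HRR.chiVal_one M δ k)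
    (HRR.chiVal_mul M δ k) fun _ _ => HRR.chiVal_congr M δ
  obtain ⟨ρ, hρ⟩ := HRR.exists_dirichletCharacter (k := 8) (HRR.rhoVal M δ k)
    (HRR.rhoVal_one M δ k) (HRR.rhoVal_mul M δ k)
    fun _ _ hab => HRR.rhoVal_congr M δ fun _ _ _ => hab
  obtain ⟨χρ, hχρ⟩ := HRR.exists_dirichletCharacter
    (fun h => HRR.chiVal M δ k h * HRR.rhoVal M δ k h)
    (by rw [HRR.chiVal_one, HRR.rhoVal_one, one_mul])
    (fun a b => by rw [HRR.chiVal_mul, HRR.rhoVal_mul]; ring)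
    (fun a b hab => by
      rw [HRR.chiVal_congr M δ hab, HRR.rhoVal_congr M δ fun m hm h2 => hab.of_dvd ?_]
      exact_mod_cast (Nat.dvd_mul_right 8 _).trans (h8k m hm h2))
  have hρ' : ∀ h : ℤ, Odd h → ρ (h : ZMod 8) = ((HRR.rhoVal M δ k h : ℤ) : ℂ) := fun h hodd =>
    hρ h (by
      obtain ⟨c, hc⟩ := hodd
      have h2 : IsCoprime h 2 := ⟨1, -c, by rw [hc]; ring⟩
      have := h2.pow_right (n := 3)
      norm_num at this ⊢
      exact this)
  refine ⟨ha, hb, χ, ρ, χρ, hχ, fun h hodd => ?_, fun h hh => ?_, fun n => ?_⟩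
  · rw [hρ' h hodd, HRR.psi_one_mul_psi hk fun _ _ _ => hodd]
  · have hodd : Odd h := by
      rw [← Int.not_even_iff_odd, even_iff_two_dvd]
      intro h2
      have := hh.of_mul_right_left.isUnit_of_dvd' h2 dvd_rfl
      exact absurd (Int.isUnit_iff.mp this) (by norm_num)
    rw [hχρ h hh.of_mul_right_right, hχ h hh.of_mul_right_right, hρ' h hodd]
    push_cast
    rfl
  · obtain ⟨a, ha'⟩ := ha
    obtain ⟨b, hb'⟩ := hb
    rw [ha', hb', Int.mul_ediv_cancel_left _ (by norm_num),
      Int.mul_ediv_cancel_left _ (by norm_num)]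
    unfold HRR.hrrCoeff HRR.twistedKloosterman
    rw [Finset.mul_sum]
    refine Finset.sum_congr rfl fun h hmem => ?_
    have hh : Nat.Coprime h k := (Finset.mem_filter.mp hmem).2
    have : NeZero k := ⟨hk.ne'⟩
    have hodd : ∀ m ∈ M, 2 ∣ HRR.kSub k m → Odd (h : ℤ) := fun m _ h2 => by
      exact_mod_cast Nat.coprime_two_right.mp
        (hh.coprime_dvd_right (h2.trans (HRR.kSub_dvd k m)))
    have hinv : (h : ℤ) * ((((h : ZMod k)⁻¹).val : ℕ) : ℤ) ≡ 1 [ZMOD k] := by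
      refine (ZMod.intCast_eq_intCast_iff _ _ k).mp ?_
      push_cast
      rw [ZMod.natCast_zmod_val]
      exact ZMod.coe_mul_inv_eq_one h hh
    have hval := hχρ (h : ℤ) (Nat.isCoprime_iff_coprime.mpr hh)
    rw [Int.cast_natCast] at hval
    rw [hval]
    refine HRR.exp_hrr_term hk hh ha' hb' hodd (fun m hm => ?_) n
    exact HRR.exp_dedekindSum_eq_etaSign hk (Nat.pos_of_dvd_of_pos (HRR.kSub_dvd k m) hk)
      (HRR.kSub_dvd k m) (HRR.mSub_coprime_kSub hk m) hh hinv (h3k m hm) (h8k m hm)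
      (hu₁ m hm) (hu₂ m hm) (hv m hm) (hw m hm) ht₁ ht₂
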